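/- **Diffeological spaces.** A diffeological space is a set $X$ with a specified family of functions $U\to X$ ($U\subseteq\mathbb R^n$ open, $n\in\mathbb N$), called plots, containing the constant functions, closed under precomposition with smooth maps, and satisfying the sheaf condition; a map is smooth if it sends plots to plots. Products, subsets and quotients carry the product, sub- and quotient diffeologies. A subset is $D$-open if its preimage under every plot is open. Smooth maps $f,g:X\to Y$ are smoothly homotopic if there is a smooth $F:X\times\mathbb R\to Y$ with $F(\cdot,0)=f$ and $F(\cdot,1)=g$; this is an equivalence relation and $[X,Y]$ denotes the set of classes. A diffeological group is a group with a diffeology for which multiplication and inversion are smooth. **Principal bundles.** Let $G$ be a diffeological group, and let $\pi:E\to B$ be a smooth map of diffeological spaces with a smooth right action of $G$ on $E$ such that $\pi(x\cdot g)=\pi(x)$. An isomorphism over $B$ is a $G$-equivariant diffeomorphism of total spaces commuting with the maps to $B$; $\pi$ is trivial if it is isomorphic to $B\times G\to B$, where $(b,g)\cdot g'=(b,gg')$. It is locally trivial if it is trivial over each member of some $D$-open cover of $B$, and it is a principal $G$-bundle if its pullback along every plot of $B$ is locally trivial. A principal $G$-bundle is $D$-numerable if there are a $D$-open cover $\{B_i\}_{i\in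 I}$ of $B$ such that each $\pi|_{B_i}$ is trivial, and smooth functions $\mu_i:B\to\mathbb R$ with $\mu_i\ge 0$ and $\sum_i\mu_i=1$, whose supports (the $D$-closures of $\mu_i^{-1}((0,\infty))$) form a locally finite family with $\operatorname{supp}\mu_i\subseteq B_i$. Write $\mathrm{Prin}^D_G(B)$ for the set of isomorphism classes of $D$-numerable principal $G$-bundles over $B$. **Classifying space.** Let $\Delta^\omega=\{t\in\oplus_\omega\mathbb R: t_i\ge 0,\ \sum_i t_i=1\}$, where a map into $\Delta^\omega$ is a plot iff all its components are smooth and, locally, all components of large enough index vanish. Let $EG$ be the quotient of $\Delta^\omega\times\prod_\omega G$ by the relation $(t,g)\sim(t',g')$ iff $t=t'$ and $g_i=g_i'$ whenever $t_i\ne0$. Let $G$ act by $[t_i,g_i]\cdot g=[t_i,g_ig]$, let $BG=EG/G$ with the quotient diffeology, and let $\pi_G:EG\to BG$ be the quotient map. A smooth homomorphism $h:G\to G'$ induces the smooth map $Bh:BG\to BG'$, $[t_i,g_i]\mapsto[t_i,h(g_i)]$. It also induces the map $h_*:\mathrm{Prin}^D_G(B)\to\mathrm{Prin}^D_{G'}(B)$,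 $[E]\mapsto[E\times_GG']$, where $E\times_GG'$ is the quotient of $E\times G'$ by $(y,f)\sim(y\cdot g,h(g)^{-1}f)$ for $g\in G$, with the right action $[y,f]\cdot k=[y,fk]$ of $G'$. **Theorem.** Let $B$ be a diffeological space and let $h:G\to G'$ be a smooth homomorphism of diffeological groups. For $K=G$ and $K=G'$, the assignment $[f]\mapsto[f^*(\pi_K)]$ is a well-defined bijection $\theta_K:[B,BK]\to\mathrm{Prin}^D_K(B)$. These bijections are natural in the group, that is, $$\theta_{G'}\circ (Bh)_* = h_*\circ\theta_G : [B,BG]\to\mathrm{Prin}^D_{G'}(B),$$ where $(Bh)_*[f]=[Bh\circ f]$. -/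

import Mathlib

open Diffeology
open scoped Topology ContDiff

universe u v w v' w'

noncomputable section

namespace DBun

/-! ### Constructions of diffeological spaces -/

/-- A map which locally agrees with plots is a plot. -/
theorem isPlot_of_locally {X : Type u} [DiffeologicalSpace X] {n : ℕ}
    {p : EuclideanSpace ℝ (Fin n) → X}
    (hp : ∀ x, ∃ q : EuclideanSpace ℝ (Fin n) → X, IsPlot q ∧ ∀ᶠ y in 𝓝 x, p y = q y) :
    IsPlot p := by
  refine DiffeologicalSpace.locality fun x => ?_
  obtain ⟨q, hq, hpq⟩ := hp x
  obtain ⟨s, hs, hso, hxs⟩ := eventually_nhds_iff.1 hpq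
  refine ⟨s, hso, hxs, fun {m f} hf hf' => ?_⟩
  have : p ∘ f = q ∘ f := funext fun z => hs _ (hf z)
  rw [this]
  exact isPlot_reparam hq hf'

/-- Near any point of an open set of `ℝⁿ` the identity extends to a smooth map
into that open set. -/
theorem exists_smooth_into {n : ℕ} {s : Set (EuclideanSpace ℝ (Fin n))} (hs : IsOpen s)
    {x : EuclideanSpace ℝ (Fin n)} (hx : x ∈ s) :
    ∃ f : EuclideanSpace ℝ (Fin n) → EuclideanSpace ℝ (Fin n),
      (∀ y, f y ∈ s) ∧ ContDiff ℝ ∞ f ∧ ∀ᶠ y in 𝓝 x, f y = y := by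
  obtain ⟨r, hr, hrs⟩ := Metric.isOpen_iff.1 hs x hx
  let b : ContDiffBump x := ⟨r / 2, r, by linarith, by linarith⟩
  refine ⟨fun y => x + b y • (y - x), fun y => hrs ?_, ?_, ?_⟩
  · rw [Metric.mem_ball, dist_eq_norm, add_sub_cancel_left, norm_smul, Real.norm_eq_abs,
      abs_of_nonneg b.nonneg]
    by_cases hy : y ∈ Metric.ball x r
    · rw [Metric.mem_ball, dist_eq_norm] at hy
      exact (mul_le_of_le_one_left (norm_nonneg _) b.le_one).trans_lt hy
    · have : b y = 0 := b.zero_of_le_dist (by simpa using hy)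
      simpa [this] using hr
  · exact contDiff_const.add (b.contDiff.smul (contDiff_id.sub contDiff_const))
  · filter_upwards [b.eventuallyEq_one] with y hy
    simp [hy]

/-- The product diffeology. -/
instance instProd {X : Type u} {Y : Type v} [DiffeologicalSpace X] [DiffeologicalSpace Y] :
    DiffeologicalSpace (X × Y) where
  plots _ := {p | IsPlot (fun x => (p x).1) ∧ IsPlot (fun x => (p x).2)}
  constant_plots _ := ⟨isPlot_const, isPlot_const⟩
  plot_reparam hp hf := ⟨isPlot_reparam hp.1 hf, isPlot_reparam hp.2 hf⟩
  locality hp := by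
    refine ⟨DiffeologicalSpace.locality fun x => ?_, DiffeologicalSpace.locality fun x => ?_⟩
    · obtain ⟨s, hs, hx, h⟩ := hp x
      exact ⟨s, hs, hx, fun h1 h2 => (h h1 h2).1⟩
    · obtain ⟨s, hs, hx, h⟩ := hp x
      exact ⟨s, hs, hx, fun h1 h2 => (h h1 h2).2⟩

/-- The product diffeology on a product of a family. -/
instance instPi {ι : Type u} {X : ι → Type v} [∀ i, DiffeologicalSpace (X i)] :
    DiffeologicalSpace (∀ i, X i) where
  plots _ := {p | ∀ i, IsPlot (fun x => p x i)}
  constant_plots _ := fun _ => isPlot_const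
  plot_reparam hp hf := fun i => isPlot_reparam (hp i) hf
  locality hp := fun i => DiffeologicalSpace.locality fun x => by
    obtain ⟨s, hs, hx, h⟩ := hp x
    exact ⟨s, hs, hx, fun h1 h2 => h h1 h2 i⟩

/-- The sub-diffeology. -/
instance instSubtype {X : Type u} [DiffeologicalSpace X] {S : X → Prop} :
    DiffeologicalSpace {x // S x} where
  plots _ := {p | IsPlot (fun x => (p x).1)}
  constant_plots _ := isPlot_const
  plot_reparam hp hf := isPlot_reparam hp hf
  locality hp := DiffeologicalSpace.locality fun x => by
    obtain ⟨s, hs, hx, h⟩ := hp x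
    exact ⟨s, hs, hx, fun h1 h2 => h h1 h2⟩

/-- The quotient diffeology: the plots are the maps that lift locally to plots. -/
instance instQuotient {X : Type u} [DiffeologicalSpace X] {r : Setoid X} :
    DiffeologicalSpace (Quotient r) where
  plots n := {p | ∀ x, ∃ q : EuclideanSpace ℝ (Fin n) → X,
    IsPlot q ∧ ∀ᶠ y in 𝓝 x, p y = Quotient.mk r (q y)}
  constant_plots c := by
    intro x
    obtain ⟨a, rfl⟩ := Quotient.exists_rep c
    exact ⟨fun _ => a, isPlot_const, Filter.Eventually.of_forall fun _ => rfl⟩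
  plot_reparam {n m p f} hp hf := by
    intro x
    obtain ⟨q, hq, h⟩ := hp (f x)
    exact ⟨q ∘ f, isPlot_reparam hq hf, hf.continuous.continuousAt.eventually h⟩
  locality {n p} hp := by
    intro x
    obtain ⟨s, hs, hx, h⟩ := hp x
    obtain ⟨f, hfs, hf, hfx⟩ := exists_smooth_into hs hx
    obtain ⟨q, hq, h'⟩ := h hfs hf x
    refine ⟨q, hq, ?_⟩
    filter_upwards [h', hfx] with y h1 h2
    rw [← h1, Function.comp_apply, h2]

theorem dSmooth_fst {X : Type u} {Y : Type v} [DiffeologicalSpace X] [DiffeologicalSpace Y] :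
    DSmooth (Prod.fst : X × Y → X) := fun _ _ hp => hp.1

theorem dSmooth_snd {X : Type u} {Y : Type v} [DiffeologicalSpace X] [DiffeologicalSpace Y] :
    DSmooth (Prod.snd : X × Y → Y) := fun _ _ hp => hp.2

theorem dSmooth_prodMk {X : Type u} {Y : Type v} {Z : Type w} [DiffeologicalSpace X]
    [DiffeologicalSpace Y] [DiffeologicalSpace Z] {f : Z → X} {g : Z → Y}
    (hf : DSmooth f) (hg : DSmooth g) : DSmooth (fun z => (f z, g z)) :=
  fun n p hp => ⟨hf n p hp, hg n p hp⟩

theorem dSmooth_val {X : Type u} [DiffeologicalSpace X] {S : X → Prop} :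
    DSmooth (Subtype.val : {x // S x} → X) := fun _ _ hp => hp

theorem dSmooth_mk {X : Type u} [DiffeologicalSpace X] {r : Setoid X} :
    DSmooth (Quotient.mk r) :=
  fun _ p hp _ => ⟨p, hp, Filter.Eventually.of_forall fun _ => rfl⟩

/-- A map out of a quotient is smooth as soon as its composite with the quotient map is. -/
theorem dSmooth_of_mk {X : Type u} {Y : Type v} [DiffeologicalSpace X] [DiffeologicalSpace Y]
    {r : Setoid X} {f : Quotient r → Y} (hf : DSmooth (fun x => f (Quotient.mk r x))) :
    DSmooth f := fun n p hp => isPlot_of_locally fun x => by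
  obtain ⟨q, hq, h⟩ := hp x
  refine ⟨_, hf n q hq, ?_⟩
  filter_upwards [h] with y hy
  simp [hy]

/-- The same for a map out of the product of a quotient with another space. -/
theorem dSmooth_of_mk_prod {X : Type u} {Y : Type v} {Z : Type w} [DiffeologicalSpace X]
    [DiffeologicalSpace Y] [DiffeologicalSpace Z] {r : Setoid X} {f : Quotient r × Z → Y}
    (hf : DSmooth (fun x : X × Z => f (Quotient.mk r x.1, x.2))) :
    DSmooth f := fun n p hp => isPlot_of_locally fun x => by
  obtain ⟨q, hq, h⟩ := hp.1 x
  refine ⟨_, hf n (fun y => (q y, (p y).2)) ⟨hq, hp.2⟩, ?_⟩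
  filter_upwards [h] with y hy
  simp [← hy]

/-! ### Smooth homotopy classes -/

/-- Smooth maps between diffeological spaces. -/
structure SmoothMap (X : Type u) (Y : Type v) [DiffeologicalSpace X] [DiffeologicalSpace Y] where
  toFun : X → Y
  smooth : DSmooth toFun

/-- The composite of smooth maps. -/
def SmoothMap.comp {X : Type u} {Y : Type v} {Z : Type w} [DiffeologicalSpace X]
    [DiffeologicalSpace Y] [DiffeologicalSpace Z] (k : SmoothMap Y Z) (f : SmoothMap X Y) :
    SmoothMap X Z := ⟨k.toFun ∘ f.toFun, k.smooth.comp f.smooth⟩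

/-- Two smooth maps are smoothly homotopic if they are the restrictions to `X × {0}` and
`X × {1}` of a smooth map on `X × ℝ`. -/
def SmoothMap.Homotopic {X : Type u} {Y : Type v} [DiffeologicalSpace X] [DiffeologicalSpace Y]
    (f g : SmoothMap X Y) : Prop :=
  ∃ F : X × ℝ → Y, DSmooth F ∧ (∀ x, F (x, 0) = f.toFun x) ∧ ∀ x, F (x, 1) = g.toFun x

/-- Smooth homotopy is an equivalence relation. -/
theorem SmoothMap.homotopic_equivalence {X : Type u} {Y : Type v} [DiffeologicalSpace X]
    [DiffeologicalSpace Y] :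
    Equivalence (SmoothMap.Homotopic : SmoothMap X Y → SmoothMap X Y → Prop) where
  refl f := ⟨fun x => f.toFun x.1, f.smooth.comp dSmooth_fst, fun _ => rfl, fun _ => rfl⟩
  symm := by
    rintro f g ⟨F, hF, h0, h1⟩
    have hs : DSmooth (fun t : ℝ => 1 - t) :=
      ContDiff.dSmooth (contDiff_const.sub contDiff_id)
    refine ⟨fun x => F (x.1, 1 - x.2), hF.comp (dSmooth_prodMk dSmooth_fst
      (hs.comp dSmooth_snd)), fun x => ?_, fun x => ?_⟩
    · simp [h1]
    · simp [h0]
  trans := by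
    rintro f g k ⟨F, hF, hF0, hF1⟩ ⟨K, hK, hK0, hK1⟩
    have hs : DSmooth (fun t : ℝ => Real.smoothTransition (4 * t)) :=
      ContDiff.dSmooth (Real.smoothTransition.contDiff.comp (contDiff_const.mul contDiff_id))
    have hs' : DSmooth (fun t : ℝ => Real.smoothTransition (4 * t - 3)) :=
      ContDiff.dSmooth (Real.smoothTransition.contDiff.comp
        ((contDiff_const.mul contDiff_id).sub contDiff_const))
    let F' : X × ℝ → Y := fun x => F (x.1, Real.smoothTransition (4 * x.2))
    let K' : X × ℝ → Y := fun x => K (x.1, Real.smoothTransition (4 * x.2 - 3))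
    have hF' : DSmooth F' := hF.comp (dSmooth_prodMk dSmooth_fst (hs.comp dSmooth_snd))
    have hK' : DSmooth K' := hK.comp (dSmooth_prodMk dSmooth_fst (hs'.comp dSmooth_snd))
    have eF : ∀ x : X × ℝ, 1 / 4 ≤ x.2 → F' x = g.toFun x.1 := fun x hx => by
      simp only [F']
      rw [Real.smoothTransition.one_of_one_le (by linarith), hF1]
    have eK : ∀ x : X × ℝ, x.2 ≤ 3 / 4 → K' x = g.toFun x.1 := fun x hx => by
      simp only [K']
      rw [Real.smoothTransition.zero_of_nonpos (by linarith), hK0]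
    refine ⟨fun x => if x.2 ≤ 1 / 2 then F' x else K' x, fun n p hp => ?_, fun x => ?_,
      fun x => ?_⟩
    · have hc : Continuous (fun y => (p y).2) := (IsPlot.contDiff hp.2).continuous
      refine isPlot_of_locally fun x => ?_
      rcases lt_or_ge (p x).2 (3 / 4) with hx | hx
      · refine ⟨_, hF' n p hp, ?_⟩
        filter_upwards [hc.continuousAt.eventually_lt continuousAt_const hx] with y hy
        by_cases h : (p y).2 ≤ 1 / 2
        · simp only [Function.comp_apply, if_pos h]
        · have h' : 1 / 4 ≤ (p y).2 := by linarith
          simp only [Function.comp_apply, if_neg h]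
          rw [eF _ h', eK _ hy.le]
      · refine ⟨_, hK' n p hp, ?_⟩
        have hx' : 1 / 2 < (p x).2 := by linarith
        filter_upwards [continuousAt_const.eventually_lt hc.continuousAt hx'] with y hy
        simp only [Function.comp_apply, if_neg (not_le.2 hy)]
    · have : Real.smoothTransition (4 * 0) = 0 := Real.smoothTransition.zero_of_nonpos (by simp)
      simp [F', hF0]
    · have : ¬ (1 : ℝ) ≤ 1 / 2 := by norm_num
      have h1 : Real.smoothTransition (4 * 1 - 3) = 1 :=
        Real.smoothTransition.one_of_one_le (by norm_num)
      simp only [if_neg this, K', h1, hK1]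

/-- The smooth homotopy relation as a setoid. -/
def SmoothMap.homotopySetoid (X : Type u) (Y : Type v) [DiffeologicalSpace X]
    [DiffeologicalSpace Y] : Setoid (SmoothMap X Y) :=
  ⟨SmoothMap.Homotopic, SmoothMap.homotopic_equivalence⟩

/-- The set `[X, Y]` of smooth homotopy classes of smooth maps `X → Y`. -/
def HomotopyClass (X : Type u) (Y : Type v) [DiffeologicalSpace X] [DiffeologicalSpace Y] :
    Type (max u v) := Quotient (SmoothMap.homotopySetoid X Y)

/-- The class `[f]`. -/
def HomotopyClass.mk {X : Type u} {Y : Type v} [DiffeologicalSpace X] [DiffeologicalSpace Y]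
    (f : SmoothMap X Y) : HomotopyClass X Y := Quotient.mk _ f

/-- The map `[X, Y] → [X, Z]`, `[f] ↦ [k ∘ f]` induced by a smooth map `k : Y → Z`. -/
def HomotopyClass.postcomp {X : Type u} {Y : Type v} {Z : Type w} [DiffeologicalSpace X]
    [DiffeologicalSpace Y] [DiffeologicalSpace Z] (k : SmoothMap Y Z) :
    HomotopyClass X Y → HomotopyClass X Z :=
  Quotient.map (fun f => k.comp f) (by
    rintro f g ⟨F, hF, h0, h1⟩
    exact ⟨k.toFun ∘ F, k.smooth.comp hF, fun x => congrArg k.toFun (h0 x),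
      fun x => congrArg k.toFun (h1 x)⟩)

/-! ### Diffeological groups and principal bundles -/

/-- A diffeological group: a group and diffeological space with smooth operations. -/
class DiffeologicalGroup (G : Type u) [Group G] [DiffeologicalSpace G] : Prop where
  smooth_mul : DSmooth (fun x : G × G => x.1 * x.2)
  smooth_inv : DSmooth (fun x : G => x⁻¹)

/-- A smooth map `proj : Total → B` of diffeological spaces together with a smooth right action
of `G` on `Total` that preserves `proj`. -/
structure GSpaceOver (G : Type u) [Group G] [DiffeologicalSpace G]
    (B : Type v) [DiffeologicalSpace B] where
  Total : Type w
  [diffeology : DiffeologicalSpace Total]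
  proj : Total → B
  act : Total → G → Total
  act_one : ∀ x, act x 1 = x
  act_mul : ∀ x g g', act x (g * g') = act (act x g) g'
  proj_act : ∀ x g, proj (act x g) = proj x
  smooth_proj : DSmooth proj
  smooth_act : DSmooth (fun x : Total × G => act x.1 x.2)

attribute [instance] GSpaceOver.diffeology

namespace GSpaceOver

section

variable {G : Type u} [Group G] [DiffeologicalSpace G] {B : Type v} [DiffeologicalSpace B]

/-- Isomorphism over `B`: a `G`-equivariant diffeomorphism commuting with the projections. -/
def Iso (P : GSpaceOver.{u, v, w} G B) (Q : GSpaceOver.{u, v, w'} G B) : Prop :=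
  ∃ e : P.Total ≃ Q.Total, DSmooth e ∧ DSmooth e.symm ∧
    (∀ x, Q.proj (e x) = P.proj x) ∧ ∀ x g, e (P.act x g) = Q.act (e x) g

theorem Iso.refl (P : GSpaceOver.{u, v, w} G B) : P.Iso P :=
  ⟨Equiv.refl _, dSmooth_id, dSmooth_id, fun _ => rfl, fun _ _ => rfl⟩

theorem Iso.symm {P : GSpaceOver.{u, v, w} G B} {Q : GSpaceOver.{u, v, w'} G B} (h : P.Iso Q) :
    Q.Iso P := by
  obtain ⟨e, h1, h2, h3, h4⟩ := h
  refine ⟨e.symm, h2, h1, fun x => ?_, fun x g => ?_⟩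
  · rw [← h3, e.apply_symm_apply]
  · rw [e.symm_apply_eq, h4, e.apply_symm_apply]

theorem Iso.trans {P : GSpaceOver.{u, v, w} G B} {Q : GSpaceOver.{u, v, w'} G B}
    {R : GSpaceOver.{u, v, v'} G B} (h : P.Iso Q) (k : Q.Iso R) : P.Iso R := by
  obtain ⟨e, h1, h2, h3, h4⟩ := h
  obtain ⟨f, k1, k2, k3, k4⟩ := k
  refine ⟨e.trans f, k1.comp h1, h2.comp k2, fun x => ?_, fun x g => ?_⟩
  · simp [h3, k3]
  · simp [h4, k4]

/-- An injective equivariant smooth map over `B` along which plots lift locally yields an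
isomorphism. -/
theorem Iso.of_lift {P : GSpaceOver.{u, v, w} G B} {Q : GSpaceOver.{u, v, w'} G B}
    (φ : P.Total → Q.Total) (hφ : DSmooth φ) (hinj : Function.Injective φ)
    (hproj : ∀ x, Q.proj (φ x) = P.proj x) (hact : ∀ x g, φ (P.act x g) = Q.act (φ x) g)
    (hlift : ∀ (n : ℕ) (p : EuclideanSpace ℝ (Fin n) → Q.Total), IsPlot p → ∀ x,
      ∃ q : EuclideanSpace ℝ (Fin n) → P.Total, IsPlot q ∧ ∀ᶠ y in 𝓝 x, p y = φ (q y)) :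
    P.Iso Q := by
  have hsurj : Function.Surjective φ := fun z => by
    obtain ⟨q, -, h⟩ := hlift 0 (fun _ => z) isPlot_const 0
    exact ⟨_, h.self_of_nhds.symm⟩
  let e := Equiv.ofBijective φ ⟨hinj, hsurj⟩
  refine ⟨e, hφ, fun n p hp => isPlot_of_locally fun x => ?_, hproj, hact⟩
  obtain ⟨q, hq, h⟩ := hlift n p hp x
  refine ⟨q, hq, ?_⟩
  filter_upwards [h] with y hy
  rw [Function.comp_apply, hy]
  exact e.symm_apply_apply (q y)

variable (G B) in
/-- The product `B × G → B` with `(b, g) · g' = (b, g g')`. -/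
def trivial [DiffeologicalGroup G] : GSpaceOver.{u, v, max v u} G B where
  Total := B × G
  proj := Prod.fst
  act x g := (x.1, x.2 * g)
  act_one x := by simp
  act_mul x g g' := by simp [mul_assoc]
  proj_act x g := rfl
  smooth_proj := dSmooth_fst
  smooth_act := dSmooth_prodMk (dSmooth_fst.comp dSmooth_fst)
    (DiffeologicalGroup.smooth_mul.comp
      (dSmooth_prodMk (dSmooth_snd.comp dSmooth_fst) dSmooth_snd))

/-- The pullback `{(b', x) | f b' = proj x} → B'` along a smooth map `f : B' → B`. -/
def pullback (P : GSpaceOver.{u, v, w} G B) {B' : Type v'} [DiffeologicalSpace B']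
    (f : B' → B) (_hf : DSmooth f) : GSpaceOver.{u, v', max v' w} G B' where
  Total := {x : B' × P.Total // f x.1 = P.proj x.2}
  proj x := x.1.1
  act x g := ⟨(x.1.1, P.act x.1.2 g), by rw [P.proj_act]; exact x.2⟩
  act_one x := Subtype.ext (Prod.ext rfl (P.act_one _))
  act_mul x g g' := Subtype.ext (Prod.ext rfl (P.act_mul _ _ _))
  proj_act x g := rfl
  smooth_proj := dSmooth_fst.comp dSmooth_val
  smooth_act := fun n p hp =>
    ⟨hp.1.1, P.smooth_act n (fun y => ((p y).1.1.2, (p y).2)) ⟨hp.1.2, hp.2⟩⟩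

/-- The restriction `proj⁻¹(S) → S` to a subset `S` of the base. -/
def restrict (P : GSpaceOver.{u, v, w} G B) (S : Set B) : GSpaceOver.{u, v, w} G S where
  Total := {x : P.Total // P.proj x ∈ S}
  proj x := ⟨P.proj x.1, x.2⟩
  act x g := ⟨P.act x.1 g, by rw [P.proj_act]; exact x.2⟩
  act_one x := Subtype.ext (P.act_one _)
  act_mul x g g' := Subtype.ext (P.act_mul _ _ _)
  proj_act x g := Subtype.ext (P.proj_act _ _)
  smooth_proj := fun n p hp => P.smooth_proj n _ hp
  smooth_act := fun n p hp => P.smooth_act n (fun y => ((p y).1.1, (p y).2)) ⟨hp.1, hp.2⟩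

variable [DiffeologicalGroup G]

/-- Trivial principal `G`-bundles. -/
def IsTrivial (P : GSpaceOver.{u, v, w} G B) : Prop := P.Iso (trivial G B)

/-- Locally trivial principal `G`-bundles: trivial over the members of a `D`-open cover. -/
def IsLocallyTrivial (P : GSpaceOver.{u, v, w} G B) : Prop :=
  ∃ 𝒰 : Set (Set B), (∀ U ∈ 𝒰, IsOpen[dTopology] U) ∧ ⋃₀ 𝒰 = Set.univ ∧
    ∀ U ∈ 𝒰, (P.restrict U).IsTrivial

/-- (Diffeological) principal `G`-bundles: the pullback along any plot is locally trivial. -/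
def IsPrincipal (P : GSpaceOver.{u, v, w} G B) : Prop :=
  ∀ (n : ℕ) (p : EuclideanSpace ℝ (Fin n) → B) (hp : IsPlot p),
    (P.pullback p hp.dSmooth).IsLocallyTrivial

end

end GSpaceOver

/-- The support of a non-negative function: the closure, in the `D`-topology, of the set where
it is positive. -/
def supp {X : Type u} [DiffeologicalSpace X] (f : X → ℝ) : Set X :=
  @closure X dTopology {x | 0 < f x}

/-- Smooth partitions of unity on a diffeological space. -/
structure IsSmoothPartitionOfUnity {X : Type u} [DiffeologicalSpace X] {ι : Type v}
    (μ : ι → X → ℝ) : Prop where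
  smooth : ∀ i, DSmooth (μ i)
  nonneg : ∀ i x, 0 ≤ μ i x
  locallyFinite : @LocallyFinite ι X dTopology (fun i => supp (μ i))
  sum_eq_one : ∀ x, ∑ᶠ i, μ i x = 1

namespace GSpaceOver

/-- `D`-numerable principal `G`-bundles: there is a smooth partition of unity subordinate to a
`D`-open cover over whose members the bundle is a trivial principal bundle. -/
def IsDNumerablePrincipal {G : Type u} [Group G] [DiffeologicalSpace G] [DiffeologicalGroup G]
    {B : Type v} [DiffeologicalSpace B] (P : GSpaceOver.{u, v, w} G B) : Prop :=
  P.IsPrincipal ∧ ∃ (ι : Type v) (μ : ι → B → ℝ) (U : ι → Set B),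
    IsSmoothPartitionOfUnity μ ∧ (∀ i, IsOpen[dTopology] (U i)) ∧ ⋃ i, U i = Set.univ ∧
    (∀ i, supp (μ i) ⊆ U i) ∧ ∀ i, (P.restrict (U i)).IsTrivial

end GSpaceOver

/-- Isomorphism of `D`-numerable principal `G`-bundles over `B`. -/
def prinSetoid (G B : Type u) [Group G] [DiffeologicalSpace G] [DiffeologicalGroup G]
    [DiffeologicalSpace B] :
    Setoid {P : GSpaceOver.{u, u, u} G B // P.IsDNumerablePrincipal} where
  r P Q := P.1.Iso Q.1
  iseqv := ⟨fun P => .refl P.1, .symm, .trans⟩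

/-- The set of isomorphism classes of `D`-numerable principal `G`-bundles over `B`. -/
def PrinD (G B : Type u) [Group G] [DiffeologicalSpace G] [DiffeologicalGroup G]
    [DiffeologicalSpace B] : Type (u + 1) := Quotient (prinSetoid G B)

/-- The isomorphism class of a `D`-numerable principal bundle. -/
def PrinD.mk {G B : Type u} [Group G] [DiffeologicalSpace G] [DiffeologicalGroup G]
    [DiffeologicalSpace B] (P : GSpaceOver.{u, u, u} G B) (hP : P.IsDNumerablePrincipal) :
    PrinD G B := Quotient.mk (prinSetoid G B) ⟨P, hP⟩

/-! ### Extension of the structure group -/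

namespace GSpaceOver

section

variable {G : Type u} [Group G] [DiffeologicalSpace G] {G' : Type u} [Group G']
  [DiffeologicalSpace G'] {B : Type v} [DiffeologicalSpace B]

/-- The relation `(y, f) ∼ (y · g, h(g)⁻¹ f)` on `E × G'`. -/
def assocSetoid (P : GSpaceOver.{u, v, w} G B) (h : G →* G') : Setoid (P.Total × G') where
  r a b := ∃ g : G, b = (P.act a.1 g, (h g)⁻¹ * a.2)
  iseqv := by
    refine ⟨fun a => ⟨1, by simp [P.act_one]⟩, ?_, ?_⟩
    · rintro a b ⟨g, rfl⟩
      refine ⟨g⁻¹, ?_⟩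
      simp [← P.act_mul, P.act_one]
    · rintro a b c ⟨g, rfl⟩ ⟨k, rfl⟩
      refine ⟨g * k, ?_⟩
      simp [← P.act_mul, mul_assoc]

variable [DiffeologicalGroup G']

/-- The associated bundle `E ×_G G' → B`, where `G` acts on `G'` by `g · g' = h(g) g'`, with the
right action `[x, g'] · k = [x, g' k]` of `G'`. -/
def extend (P : GSpaceOver.{u, v, w} G B) (h : G →* G') :
    GSpaceOver.{u, v, max w u} G' B where
  Total := Quotient (P.assocSetoid h)
  proj := Quotient.lift (fun a => P.proj a.1) (by
    rintro a b ⟨g, rfl⟩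
    exact (P.proj_act _ _).symm)
  act c k := Quotient.map (fun a => (a.1, a.2 * k)) (by
    rintro a b ⟨g, rfl⟩
    exact ⟨g, by simp [mul_assoc]⟩) c
  act_one c := by
    induction c using Quotient.inductionOn
    simp
  act_mul c k k' := by
    induction c using Quotient.inductionOn
    simp [mul_assoc]
  proj_act c k := by
    induction c using Quotient.inductionOn
    rfl
  smooth_proj := dSmooth_of_mk (P.smooth_proj.comp dSmooth_fst)
  smooth_act := dSmooth_of_mk_prod (dSmooth_mk.comp
    (dSmooth_prodMk (dSmooth_fst.comp dSmooth_fst)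
      (DiffeologicalGroup.smooth_mul.comp
        (dSmooth_prodMk (dSmooth_snd.comp dSmooth_fst) dSmooth_snd))))

theorem extend_iso {P : GSpaceOver.{u, v, w} G B} {Q : GSpaceOver.{u, v, w'} G B} (h : G →* G')
    (i : P.Iso Q) : (P.extend h).Iso (Q.extend h) := by
  obtain ⟨e, h1, h2, h3, h4⟩ := i
  refine Iso.of_lift (P := P.extend h) (Q := Q.extend h)
    (Quotient.map (fun a => (e a.1, a.2)) ?_) ?_ ?_ ?_ ?_ ?_
  · rintro a b ⟨g, rfl⟩
    exact ⟨g, by simp [h4]⟩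
  · exact dSmooth_of_mk (dSmooth_mk.comp
      (dSmooth_prodMk (h1.comp dSmooth_fst) dSmooth_snd))
  · intro c d
    refine Quotient.inductionOn₂ c d fun a b hab => ?_
    obtain ⟨g, hg⟩ := Quotient.exact hab
    refine Quotient.sound ⟨g, ?_⟩
    rw [Prod.ext_iff] at hg ⊢
    exact ⟨e.injective (by rw [h4]; exact hg.1), hg.2⟩
  · intro c
    exact Quotient.inductionOn c fun a => h3 a.1
  · intro c g
    exact Quotient.inductionOn c fun a => rfl
  · intro n p hp x
    obtain ⟨q, hq, hpq⟩ := hp x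
    refine ⟨fun y => Quotient.mk _ (e.symm (q y).1, (q y).2),
      dSmooth_mk n (fun y => (e.symm (q y).1, (q y).2)) ⟨h2 n _ hq.1, hq.2⟩, ?_⟩
    filter_upwards [hpq] with y hy
    rw [hy]
    refine congrArg (Quotient.mk (Q.assocSetoid h)) (Prod.ext ?_ rfl)
    exact (e.apply_symm_apply _).symm

theorem extend_trivial [DiffeologicalGroup G] (h : G →* G') (hh : DSmooth h) :
    ((trivial G B).extend h).IsTrivial := by
  refine Iso.of_lift (P := (trivial G B).extend h) (Q := trivial G' B)
    (Quotient.lift (fun a => (a.1.1, h a.1.2 * a.2)) ?_) ?_ ?_ ?_ ?_ ?_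
  · rintro a b ⟨g, rfl⟩
    simp [trivial]
  · exact dSmooth_of_mk (dSmooth_prodMk (dSmooth_fst.comp dSmooth_fst)
      (DiffeologicalGroup.smooth_mul.comp
        (dSmooth_prodMk (hh.comp (dSmooth_snd.comp dSmooth_fst)) dSmooth_snd)))
  · intro c d
    refine Quotient.inductionOn₂ c d fun a b hab => ?_
    obtain ⟨⟨a1, a2⟩, a3⟩ := a
    obtain ⟨⟨b1, b2⟩, b3⟩ := b
    obtain ⟨hb, hg⟩ := Prod.ext_iff.1 hab
    have hb' : a1 = b1 := hb
    have hg' : h a2 * a3 = h b2 * b3 := hg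
    refine Quotient.sound ⟨a2⁻¹ * b2, ?_⟩
    refine Prod.ext (Prod.ext hb'.symm (mul_inv_cancel_left a2 b2).symm) ?_
    change b3 = (h (a2⁻¹ * b2))⁻¹ * a3
    rw [map_mul, map_inv, mul_inv_rev, inv_inv, mul_assoc, hg', inv_mul_cancel_left]
  · intro c
    exact Quotient.inductionOn c fun a => rfl
  · intro c g
    refine Quotient.inductionOn c fun a => ?_
    exact Prod.ext rfl (mul_assoc _ _ _).symm
  · intro n p hp x
    refine ⟨fun y => Quotient.mk _ (((p y).1, 1), (p y).2),
      dSmooth_mk n (fun y => (((p y).1, (1 : G)), (p y).2)) ⟨⟨hp.1, isPlot_const⟩, hp.2⟩,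
      Filter.Eventually.of_forall fun y => ?_⟩
    change p y = ((p y).1, h 1 * (p y).2)
    rw [map_one, one_mul]
    rfl

theorem extend_isTrivial [DiffeologicalGroup G] {P : GSpaceOver.{u, v, w} G B} (h : G →* G')
    (hh : DSmooth h) (hP : P.IsTrivial) : (P.extend h).IsTrivial :=
  (extend_iso h hP).trans (extend_trivial h hh)

theorem extend_pullback (P : GSpaceOver.{u, v, w} G B) (h : G →* G') {B' : Type v'}
    [DiffeologicalSpace B'] (f : B' → B) (hf : DSmooth f) :
    ((P.pullback f hf).extend h).Iso ((P.extend h).pullback f hf) := by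
  let φ : ((P.pullback f hf).extend h).Total → (P.extend h).Total :=
    Quotient.map (sa := (P.pullback f hf).assocSetoid h) (sb := P.assocSetoid h)
      (fun a => (a.1.1.2, a.2)) (by rintro a b ⟨g, rfl⟩; exact ⟨g, rfl⟩)
  have hφ : DSmooth φ := dSmooth_of_mk (DSmooth.comp (g := Quotient.mk (P.assocSetoid h)) dSmooth_mk
    (f := fun a : (P.pullback f hf).Total × G' => (a.1.1.2, a.2))
    fun n p hp => ⟨hp.1.2, hp.2⟩)
  have key : ∀ c, f (((P.pullback f hf).extend h).proj c) = (P.extend h).proj (φ c) := fun c =>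
    Quotient.inductionOn c fun a => a.1.2
  refine Iso.of_lift (P := (P.pullback f hf).extend h) (Q := (P.extend h).pullback f hf)
    (fun c => ⟨(_, φ c), key c⟩) ?_ ?_ ?_ ?_ ?_
  · exact fun n p hp => ⟨((P.pullback f hf).extend h).smooth_proj n p hp, hφ n p hp⟩
  · intro c d
    refine Quotient.inductionOn₂ c d fun a b hab => ?_
    obtain ⟨hb, hq⟩ := Prod.ext_iff.1 (Subtype.ext_iff.1 hab)
    obtain ⟨g, hg⟩ := Quotient.exact hq
    obtain ⟨hg1, hg2⟩ := Prod.ext_iff.1 hg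
    exact Quotient.sound ⟨g, Prod.ext (Subtype.ext (Prod.ext hb.symm hg1)) hg2⟩
  · intro c
    rfl
  · intro c g
    exact Quotient.inductionOn c fun a => rfl
  · intro n p hp x
    obtain ⟨q, hq, hpq⟩ := hp.2 x
    obtain ⟨s, hs, hso, hxs⟩ := eventually_nhds_iff.1 hpq
    obtain ⟨k, hks, hk, hkx⟩ := exists_smooth_into hso hxs
    have hm : ∀ y, f (p (k y)).1.1 = P.proj (q (k y)).1 := fun y => by
      exact (p (k y)).2.trans (congrArg (P.extend h).proj (hs _ (hks y)))
    refine ⟨fun y => Quotient.mk _ (⟨((p (k y)).1.1, (q (k y)).1), hm y⟩, (q (k y)).2),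
      dSmooth_mk n (fun y => ((⟨((p (k y)).1.1, (q (k y)).1), hm y⟩ :
        (P.pullback f hf).Total), (q (k y)).2))
        ⟨⟨isPlot_reparam hp.1 hk, isPlot_reparam hq.1 hk⟩, isPlot_reparam hq.2 hk⟩, ?_⟩
    filter_upwards [hkx, hpq] with y hy hy'
    refine Subtype.ext (Prod.ext ?_ ?_)
    · exact congrArg (fun z => (p z).1.1) hy.symm
    · refine hy'.trans ?_
      exact congrArg (fun z => Quotient.mk (P.assocSetoid h) (q z)) hy.symm

theorem extend_restrict (P : GSpaceOver.{u, v, w} G B) (h : G →* G') (S : Set B) :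
    ((P.restrict S).extend h).Iso ((P.extend h).restrict S) := by
  let φ : ((P.restrict S).extend h).Total → (P.extend h).Total :=
    Quotient.map (sa := (P.restrict S).assocSetoid h) (sb := P.assocSetoid h)
      (fun a => (a.1.1, a.2)) (by rintro a b ⟨g, rfl⟩; exact ⟨g, rfl⟩)
  have hφ : DSmooth φ := dSmooth_of_mk (DSmooth.comp (g := Quotient.mk (P.assocSetoid h)) dSmooth_mk
    (f := fun a : (P.restrict S).Total × G' => (a.1.1, a.2))
    fun n p hp => ⟨hp.1, hp.2⟩)
  have key : ∀ c, (P.extend h).proj (φ c) ∈ S := fun c =>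
    Quotient.inductionOn c fun a => a.1.2
  refine Iso.of_lift (P := (P.restrict S).extend h) (Q := (P.extend h).restrict S)
    (fun c => ⟨φ c, key c⟩) ?_ ?_ ?_ ?_ ?_
  · exact fun n p hp => hφ n p hp
  · intro c d
    refine Quotient.inductionOn₂ c d fun a b hab => ?_
    obtain ⟨g, hg⟩ := Quotient.exact (Subtype.ext_iff.1 hab)
    obtain ⟨hg1, hg2⟩ := Prod.ext_iff.1 hg
    exact Quotient.sound ⟨g, Prod.ext (Subtype.ext hg1) hg2⟩
  · intro c
    exact Quotient.inductionOn c fun a => rfl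
  · intro c g
    exact Quotient.inductionOn c fun a => rfl
  · intro n p hp x
    obtain ⟨q, hq, hpq⟩ := hp x
    obtain ⟨s, hs, hso, hxs⟩ := eventually_nhds_iff.1 hpq
    obtain ⟨k, hks, hk, hkx⟩ := exists_smooth_into hso hxs
    have hm : ∀ y, P.proj (q (k y)).1 ∈ S := fun y => by
      have h1 : (P.extend h).proj (p (k y)).1 = P.proj (q (k y)).1 :=
        congrArg (P.extend h).proj (hs _ (hks y))
      exact h1 ▸ (p (k y)).2
    refine ⟨fun y => Quotient.mk _ (⟨(q (k y)).1, hm y⟩, (q (k y)).2),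
      dSmooth_mk n (fun y => ((⟨(q (k y)).1, hm y⟩ : (P.restrict S).Total), (q (k y)).2))
        ⟨isPlot_reparam hq.1 hk, isPlot_reparam hq.2 hk⟩, ?_⟩
    filter_upwards [hkx, hpq] with y hy hy'
    refine Subtype.ext (hy'.trans ?_)
    exact congrArg (fun z => Quotient.mk (P.assocSetoid h) (q z)) hy.symm

theorem restrict_iso {P : GSpaceOver.{u, v, w} G B} {Q : GSpaceOver.{u, v, w'} G B}
    (i : P.Iso Q) (S : Set B) : (P.restrict S).Iso (Q.restrict S) := by
  obtain ⟨e, h1, h2, h3, h4⟩ := i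
  refine Iso.of_lift (P := P.restrict S) (Q := Q.restrict S)
    (fun x => ⟨e x.1, by rw [h3]; exact x.2⟩) (fun n p hp => h1 n _ hp)
    (fun x y hxy => Subtype.ext (e.injective (Subtype.ext_iff.1 hxy)))
    (fun x => Subtype.ext (h3 _)) (fun x g => Subtype.ext (h4 _ _)) fun n p hp x => ?_
  refine ⟨fun y => ⟨e.symm (p y).1, ?_⟩, h2 n _ hp, Filter.Eventually.of_forall fun y => ?_⟩
  · rw [← h3, e.apply_symm_apply]
    exact (p y).2
  · exact Subtype.ext (e.apply_symm_apply _).symm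

theorem extend_isDNumerablePrincipal [DiffeologicalGroup G] {P : GSpaceOver.{u, v, w} G B}
    (h : G →* G') (hh : DSmooth h) (hP : P.IsDNumerablePrincipal) :
    (P.extend h).IsDNumerablePrincipal := by
  obtain ⟨hP, ι, μ, U, hμ, hU, hc, hs, ht⟩ := hP
  refine ⟨fun n p hp => ?_, ι, μ, U, hμ, hU, hc, hs, fun i => ?_⟩
  · obtain ⟨𝒰, h1, h2, h3⟩ := hP n p hp
    refine ⟨𝒰, h1, h2, fun V hV => ?_⟩
    exact (restrict_iso (extend_pullback P h p hp.dSmooth) V).symm.trans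
      ((extend_restrict _ h V).symm.trans (extend_isTrivial h hh (h3 V hV)))
  · exact (extend_restrict P h (U i)).symm.trans (extend_isTrivial h hh (ht i))

end

end GSpaceOver

/-- The map `h_*` on isomorphism classes of `D`-numerable principal bundles,
`[E] ↦ [E ×_G G']`, induced by a smooth homomorphism `h : G → G'`. -/
def PrinD.extend {G G' B : Type u} [Group G] [DiffeologicalSpace G] [DiffeologicalGroup G]
    [Group G'] [DiffeologicalSpace G'] [DiffeologicalGroup G'] [DiffeologicalSpace B]
    (h : G →* G') (hh : DSmooth h) : PrinD G B → PrinD G' B :=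
  Quotient.map (fun P => ⟨P.1.extend h, GSpaceOver.extend_isDNumerablePrincipal h hh P.2⟩)
    fun _ _ i => GSpaceOver.extend_iso h i

/-! ### The universal bundle -/

/-- The diffeology of `⊕_ω ℝ`: a map is a plot if all its components are smooth and, locally,
all but finitely many of them vanish. -/
instance instFinsupp : DiffeologicalSpace (ℕ →₀ ℝ) where
  plots n := {p | (∀ i, IsPlot (fun x => p x i)) ∧
    ∀ x : EuclideanSpace ℝ (Fin n), ∃ N : ℕ, ∀ᶠ y in 𝓝 x, ∀ i, N < i → p y i = 0}
  constant_plots c := by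
    refine ⟨fun i => isPlot_const, fun x => ?_⟩
    obtain ⟨N, hN⟩ := c.support.bddAbove
    refine ⟨N, Filter.Eventually.of_forall fun y i hi => ?_⟩
    by_contra hc
    exact absurd (hN (Finsupp.mem_support_iff.2 hc)) (not_le.2 hi)
  plot_reparam {n m p f} hp hf := by
    refine ⟨fun i => isPlot_reparam (hp.1 i) hf, fun x => ?_⟩
    obtain ⟨N, hN⟩ := hp.2 (f x)
    exact ⟨N, hf.continuous.continuousAt.eventually hN⟩
  locality {n p} hp := by
    refine ⟨fun i => DiffeologicalSpace.locality fun x => ?_, fun x => ?_⟩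
    · obtain ⟨s, hs, hx, h⟩ := hp x
      exact ⟨s, hs, hx, fun h1 h2 => (h h1 h2).1 i⟩
    · obtain ⟨s, hs, hx, h⟩ := hp x
      obtain ⟨f, hfs, hf, hfx⟩ := exists_smooth_into hs hx
      obtain ⟨N, hN⟩ := (h hfs hf).2 x
      refine ⟨N, ?_⟩
      filter_upwards [hN, hfx] with y h1 h2
      rwa [Function.comp_apply, h2] at h1

/-- The infinite simplex, with the sub-diffeology of `⊕_ω ℝ`. -/
abbrev Simplex : Type :=
  {t : ℕ →₀ ℝ // (t.sum fun _ a => a) = 1 ∧ ∀ i, 0 ≤ t i}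

/-- `(t_i, g_i) ∼ (t'_i, g'_i)` if `t = t'`, and `g_i = g'_i` whenever `t_i ≠ 0`. -/
def eSetoid (G : Type u) : Setoid (Simplex × (ℕ → G)) where
  r a b := a.1 = b.1 ∧ ∀ i, a.1.1 i ≠ 0 → a.2 i = b.2 i
  iseqv := by
    refine ⟨fun a => ⟨rfl, fun _ _ => rfl⟩, ?_, ?_⟩
    · rintro a b ⟨h1, h2⟩
      exact ⟨h1.symm, fun i hi => (h2 i (by rwa [h1])).symm⟩
    · rintro a b c ⟨h1, h2⟩ ⟨k1, k2⟩
      exact ⟨h1.trans k1, fun i hi => (h2 i hi).trans (k2 i (by rwa [← h1]))⟩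

/-- The total space `EG`, with the quotient diffeology. -/
abbrev EG (G : Type u) : Type u := Quotient (eSetoid G)

section

variable {G : Type u} [Group G]

/-- The right action `[t_i, g_i] · g = [t_i, g_i g]` on `EG`. -/
def EG.act (c : EG G) (g : G) : EG G :=
  Quotient.map (fun a => (a.1, fun i => a.2 i * g)) (by
    rintro a b ⟨h1, h2⟩
    exact ⟨h1, fun i hi => congrArg (· * g) (h2 i hi)⟩) c

theorem EG.act_one (c : EG G) : EG.act c 1 = c := by
  induction c using Quotient.inductionOn
  simp [EG.act]

theorem EG.act_mul (c : EG G) (g g' : G) : EG.act c (g * g') = EG.act (EG.act c g) g' := by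
  induction c using Quotient.inductionOn
  simp [EG.act, mul_assoc]

variable (G) in
/-- The orbit relation on `EG`. -/
def bSetoid : Setoid (EG G) where
  r c d := ∃ g : G, d = EG.act c g
  iseqv := by
    refine ⟨fun c => ⟨1, (EG.act_one c).symm⟩, ?_, ?_⟩
    · rintro c d ⟨g, rfl⟩
      exact ⟨g⁻¹, by rw [← EG.act_mul, mul_inv_cancel, EG.act_one]⟩
    · rintro c d e ⟨g, rfl⟩ ⟨k, rfl⟩
      exact ⟨g * k, (EG.act_mul c g k).symm⟩

variable (G) in
/-- The classifying space `BG`: the orbit space of `EG`, with the quotient diffeology. -/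
abbrev BG : Type u := Quotient (bSetoid G)

variable [DiffeologicalSpace G]

theorem EG.smooth_act [DiffeologicalGroup G] :
    DSmooth (fun x : EG G × G => EG.act x.1 x.2) :=
  dSmooth_of_mk_prod (dSmooth_mk.comp (dSmooth_prodMk (dSmooth_fst.comp dSmooth_fst)
    fun n p hp i => DiffeologicalGroup.smooth_mul n (fun y => ((p y).1.2 i, (p y).2))
      ⟨hp.1.2 i, hp.2⟩))

variable (G) in
/-- The quotient map `EG → BG`, with the action of `G` on `EG`. -/
def universalBundle [DiffeologicalGroup G] : GSpaceOver.{u, u, u} G (BG G) where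
  Total := EG G
  proj := Quotient.mk (bSetoid G)
  act := EG.act
  act_one := EG.act_one
  act_mul := EG.act_mul
  proj_act c g := (Quotient.sound (s := bSetoid G) ⟨g, rfl⟩).symm
  smooth_proj := dSmooth_mk
  smooth_act := EG.smooth_act

variable {G' : Type u} [Group G'] [DiffeologicalSpace G']

/-- The map `Eh : EG → EG'`, `[t_i, g_i] ↦ [t_i, h(g_i)]`. -/
def EG.map (h : G →* G') : EG G → EG G' :=
  Quotient.map (fun a => (a.1, fun i => h (a.2 i))) (by
    rintro a b ⟨h1, h2⟩
    exact ⟨h1, fun i hi => congrArg h (h2 i hi)⟩)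

/-- The smooth map `Bh : BG → BG'`, `[t_i, g_i] ↦ [t_i, h(g_i)]`, induced by a smooth
homomorphism `h`. -/
def BG.map (h : G →* G') (hh : DSmooth h) : SmoothMap (BG G) (BG G') where
  toFun := Quotient.map (EG.map h) (by
    intro c _ ⟨g, hg⟩
    refine ⟨h g, ?_⟩
    rw [hg]
    induction c using Quotient.inductionOn
    simp [EG.act, EG.map])
  smooth := dSmooth_of_mk (dSmooth_mk.comp (dSmooth_of_mk (dSmooth_mk.comp
    (dSmooth_prodMk dSmooth_fst fun n p hp i => hh n _ (hp.2 i)))))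

end

/-- `θ : [B, BG] → Prin_G^D(B)` is the map `[f] ↦ [f^*(EG → BG)]`. -/
def IsPullbackMap {G B : Type u} [Group G] [DiffeologicalSpace G] [DiffeologicalGroup G]
    [DiffeologicalSpace B] (θ : HomotopyClass B (BG G) → PrinD G B) : Prop :=
  ∀ f : SmoothMap B (BG G),
    ∃ hf : ((universalBundle G).pullback f.toFun f.smooth).IsDNumerablePrincipal,
      θ (HomotopyClass.mk f) = PrinD.mk _ hf

end DBun

end

noncomputable section

namespace DBun

/-! A `D`-numerable bundle is treated as a smooth torsor (`IsTorsor`): the action is free and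
transitive on fibres, division of plots is a plot, and plots of the base lift locally. A smooth
equivariant map over the base between torsors is automatically an isomorphism (`Iso.of_isTorsor`).
Hence `P` is isomorphic to the pullback of `EG` along `f` as soon as some smooth equivariant map
from `P` to `EG` covers `f` (`IsTorsor.iso_pullback`), and the theorem becomes a statement about
such maps.

Surjectivity. An arbitrary subordinate partition of unity is first made countable: the functions
`bump μ S` with `S` of fixed cardinality have disjoint nonvanishing sets, so one chart per
cardinality is enough (`exists_isNumeration`). Countably many weights and charts are then the
coordinates of a map to `EG` (`IsNumeration.exists_classifying`). The self-map `shrink` of the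
simplex makes each weight vanish near the points where its chart is undefined, and makes supports
locally finite.

Injectivity. Two equivariant maps from `P` to `EG` are equivariantly homotopic
(`IsTorsor.homotopic_of_classifying`): their coordinates are moved to disjoint sets of places and
the results are joined by segments in the simplex. The move is smooth because coordinates of large
index go first, so every place is vacated before a new coordinate arrives. Equivariant homotopies
descend to the base.

Well-definedness. For a homotopy `F : B × ℝ → BG`, the coordinates of `F` supply the charts for
transport in the time direction. The energy of the normalized coordinate curves depends smoothly on
`b` and yields a smooth step size during which every large coordinate stays nonzero (`exists_step`).
A step is divided into portions given by the shrunk coordinates, the `n`-th being transported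
through the `n`-th chart (`exists_isTransport_step`). Locally finitely many steps are nontrivial, so
they compose to an isomorphism of the pullbacks.

Naturality. The map `[x, k] ↦ Eh(x) · k` is equivariant from the extended bundle to `EG'` and covers
`Bh ∘ f`. -/

/-! ### Locality of plots and the `D`-topology -/

/-- The locality axiom, restated: a map whose reparametrizations into small open sets are plots
is a plot. -/
theorem isPlot_of_nhds {X : Type u} [DiffeologicalSpace X] {n : ℕ}
    {p : EuclideanSpace ℝ (Fin n) → X}
    (hp : ∀ z, ∃ S : Set (EuclideanSpace ℝ (Fin n)), S ∈ 𝓝 z ∧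
      ∀ (m : ℕ) (k : EuclideanSpace ℝ (Fin m) → EuclideanSpace ℝ (Fin n)),
        (∀ y, k y ∈ S) → ContDiff ℝ ∞ k → IsPlot (p ∘ k)) : IsPlot p := by
  refine DiffeologicalSpace.locality fun z => ?_
  obtain ⟨S, hS, h⟩ := hp z
  obtain ⟨T, hTS, hT, hz⟩ := mem_nhds_iff.1 hS
  exact ⟨T, hT, hz, fun {m k} hk hk' => h m k (fun y => hTS (hk y)) hk'⟩

/-- Near any point the identity of `ℝⁿ` extends to a smooth map into a given neighbourhood. -/
theorem exists_smooth_into_nhds {n : ℕ} {S : Set (EuclideanSpace ℝ (Fin n))}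
    {z : EuclideanSpace ℝ (Fin n)} (hS : S ∈ 𝓝 z) :
    ∃ k : EuclideanSpace ℝ (Fin n) → EuclideanSpace ℝ (Fin n),
      (∀ y, k y ∈ S) ∧ ContDiff ℝ ∞ k ∧ ∀ᶠ y in 𝓝 z, k y = y := by
  obtain ⟨T, hTS, hT, hz⟩ := mem_nhds_iff.1 hS
  obtain ⟨k, hk, h⟩ := exists_smooth_into hT hz
  exact ⟨k, fun y => hTS (hk y), h⟩

/-- A smooth real function is continuous along every plot. -/
theorem IsPlot.continuous_real {X : Type u} [DiffeologicalSpace X] {f : X → ℝ} (hf : DSmooth f)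
    {n : ℕ} {p : EuclideanSpace ℝ (Fin n) → X} (hp : IsPlot p) : Continuous fun y => f (p y) :=
  (IsPlot.contDiff (hf n p hp)).continuous

theorem isOpen_dTopology_lt {X : Type u} [DiffeologicalSpace X] {f g : X → ℝ} (hf : DSmooth f)
    (hg : DSmooth g) : IsOpen[dTopology] {x | f x < g x} :=
  isOpen_iff_preimages_plots.2 fun _ _ hp =>
    isOpen_lt (IsPlot.continuous_real hf hp) (IsPlot.continuous_real hg hp)

theorem isClosed_dTopology_le {X : Type u} [DiffeologicalSpace X] {f g : X → ℝ} (hf : DSmooth f)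
    (hg : DSmooth g) : IsClosed[dTopology] {x | f x ≤ g x} := by
  rw [← @isOpen_compl_iff _ _ dTopology]
  convert! isOpen_dTopology_lt hg hf using 1
  ext x
  simp

theorem isOpen_dTopology_ne_zero {X : Type u} [DiffeologicalSpace X] {f : X → ℝ}
    (hf : DSmooth f) : IsOpen[dTopology] {x | f x ≠ 0} :=
  isOpen_iff_preimages_plots.2 fun _ _ hp =>
    isOpen_ne_fun (IsPlot.continuous_real hf hp) continuous_const

theorem IsPlot.mul {G : Type u} [Group G] [DiffeologicalSpace G] [DiffeologicalGroup G] {n : ℕ}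
    {p q : EuclideanSpace ℝ (Fin n) → G} (hp : IsPlot p) (hq : IsPlot q) :
    IsPlot fun y => p y * q y :=
  DiffeologicalGroup.smooth_mul n (fun y => (p y, q y)) ⟨hp, hq⟩

theorem IsPlot.inv {G : Type u} [Group G] [DiffeologicalSpace G] [DiffeologicalGroup G] {n : ℕ}
    {p : EuclideanSpace ℝ (Fin n) → G} (hp : IsPlot p) : IsPlot fun y => (p y)⁻¹ :=
  DiffeologicalGroup.smooth_inv n p hp

/-! ### Principal bundles as smooth torsors -/

namespace GSpaceOver

variable {G : Type u} [Group G] [DiffeologicalSpace G] {B : Type v} [DiffeologicalSpace B]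

theorem act_plot (P : GSpaceOver.{u, v, w} G B) {n : ℕ}
    {p : EuclideanSpace ℝ (Fin n) → P.Total} {γ : EuclideanSpace ℝ (Fin n) → G}
    (hp : IsPlot p) (hγ : IsPlot γ) : IsPlot fun y => P.act (p y) (γ y) :=
  P.smooth_act n (fun y => (p y, γ y)) ⟨hp, hγ⟩

theorem act_inv_act (P : GSpaceOver.{u, v, w} G B) (x : P.Total) (g : G) :
    P.act (P.act x g) g⁻¹ = x := by
  rw [← P.act_mul, mul_inv_cancel, P.act_one]

/-- The action is free and transitive on the fibres, with smooth division, and plots of the base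
lift locally. -/
structure IsTorsor (P : GSpaceOver.{u, v, w} G B) : Prop where
  free : ∀ x g, P.act x g = x → g = 1
  trans : ∀ x y, P.proj x = P.proj y → ∃ g, P.act x g = y
  div : ∀ (n : ℕ) (p q : EuclideanSpace ℝ (Fin n) → P.Total) (γ : EuclideanSpace ℝ (Fin n) → G),
    IsPlot p → IsPlot q → (∀ y, P.act (p y) (γ y) = q y) → IsPlot γ
  lift : ∀ (n : ℕ) (p : EuclideanSpace ℝ (Fin n) → B), IsPlot p → ∀ z,
    ∃ q : EuclideanSpace ℝ (Fin n) → P.Total, IsPlot q ∧ ∀ᶠ y in 𝓝 z, P.proj (q y) = p y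

theorem IsTorsor.surjective {P : GSpaceOver.{u, v, w} G B} (hP : P.IsTorsor) :
    Function.Surjective P.proj := fun b => by
  obtain ⟨q, -, h⟩ := hP.lift 0 (fun _ => b) isPlot_const 0
  exact ⟨_, h.self_of_nhds⟩

theorem IsTorsor.act_injective {P : GSpaceOver.{u, v, w} G B} (hP : P.IsTorsor) (x : P.Total)
    {g g' : G} (h : P.act x g = P.act x g') : g = g' := by
  have := hP.free x (g' * g⁻¹) (by rw [P.act_mul, ← h, P.act_inv_act])
  exact (mul_inv_eq_one.1 this).symm

/-- Two plots over the same plot of the base differ by a plot of the group. -/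
theorem IsTorsor.exists_div {P : GSpaceOver.{u, v, w} G B} (hP : P.IsTorsor) {n : ℕ}
    {p q : EuclideanSpace ℝ (Fin n) → P.Total} (hp : IsPlot p) (hq : IsPlot q)
    (h : ∀ y, P.proj (p y) = P.proj (q y)) :
    ∃ γ : EuclideanSpace ℝ (Fin n) → G, IsPlot γ ∧ ∀ y, P.act (p y) (γ y) = q y := by
  choose γ hγ using fun y => hP.trans _ _ (h y)
  exact ⟨γ, hP.div n p q γ hp hq hγ, hγ⟩

/-- A smooth equivariant map over the base between torsors is an isomorphism. -/
theorem Iso.of_isTorsor {P : GSpaceOver.{u, v, w} G B} {Q : GSpaceOver.{u, v, w'} G B}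
    (hP : P.IsTorsor) (hQ : Q.IsTorsor) (φ : P.Total → Q.Total) (hφ : DSmooth φ)
    (hproj : ∀ x, Q.proj (φ x) = P.proj x) (hact : ∀ x g, φ (P.act x g) = Q.act (φ x) g) :
    P.Iso Q := by
  refine Iso.of_lift φ hφ (fun x y hxy => ?_) hproj hact fun n p hp z => ?_
  · obtain ⟨g, rfl⟩ := hP.trans x y (by rw [← hproj, ← hproj, hxy])
    rw [hact] at hxy
    rw [hQ.free _ _ hxy.symm, P.act_one]
  · obtain ⟨q, hq, h⟩ := hP.lift n _ (Q.smooth_proj n p hp) z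
    obtain ⟨k, hk, hk', hkz⟩ := exists_smooth_into_nhds h
    -- The lift `q` of the projected plot need not map to `p` under `φ`; the discrepancy is a plot
    -- of the group, found by division in `Q` and applied in `P`.
    obtain ⟨γ, hγ, hγ'⟩ := hQ.exists_div (p := fun y => φ (q (k y))) (q := p ∘ k)
      (hφ n _ (isPlot_reparam hq hk')) (isPlot_reparam hp hk')
      fun y => (hproj _).trans (hk y)
    refine ⟨_, P.act_plot (isPlot_reparam hq hk') hγ, ?_⟩
    filter_upwards [hkz] with y hy
    rw [hact, Function.comp_apply, hγ' y, Function.comp_apply, hy]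

theorem IsTorsor.pullback {P : GSpaceOver.{u, v, w} G B} (hP : P.IsTorsor) {B' : Type v'}
    [DiffeologicalSpace B'] {f : B' → B} (hf : DSmooth f) : (P.pullback f hf).IsTorsor where
  free x g h := hP.free x.1.2 g (congrArg (fun z => z.1.2) h)
  trans x y h := by
    have h' : x.1.1 = y.1.1 := h
    obtain ⟨g, hg⟩ := hP.trans x.1.2 y.1.2 (by rw [← x.2, ← y.2, h'])
    exact ⟨g, Subtype.ext (Prod.ext h' hg)⟩
  div n p q γ hp hq h := hP.div n _ _ γ hp.2 hq.2 fun y => congrArg (fun z => z.1.2) (h y)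
  lift n p hp z := by
    obtain ⟨q, hq, h⟩ := hP.lift n _ (hf n p hp) z
    -- A map into the pullback must be compatible at every parameter, not only near `z`;
    -- reparametrizing by `k` achieves this without changing germs at `z`.
    obtain ⟨k, hk, hk', hkz⟩ := exists_smooth_into_nhds h
    refine ⟨fun y => ⟨(p (k y), q (k y)), (hk y).symm⟩,
      ⟨isPlot_reparam hp hk', isPlot_reparam hq hk'⟩, ?_⟩
    filter_upwards [hkz] with y hy
    exact congrArg p hy

theorem IsTorsor.restrict {P : GSpaceOver.{u, v, w} G B} (hP : P.IsTorsor) (S : Set B) :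
    (P.restrict S).IsTorsor where
  free x g h := hP.free x.1 g (congrArg Subtype.val h)
  trans x y h := by
    obtain ⟨g, hg⟩ := hP.trans x.1 y.1 (congrArg Subtype.val h)
    exact ⟨g, Subtype.ext hg⟩
  div n p q γ hp hq h := hP.div n _ _ γ hp hq fun y => congrArg Subtype.val (h y)
  lift n p hp z := by
    obtain ⟨q, hq, h⟩ := hP.lift n (fun y => (p y).1) hp z
    obtain ⟨k, hk, hk', hkz⟩ := exists_smooth_into_nhds h
    have hk'' : ∀ y, P.proj (q (k y)) = (p (k y)).1 := hk
    refine ⟨fun y => ⟨q (k y), by rw [hk'']; exact (p (k y)).2⟩, isPlot_reparam hq hk', ?_⟩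
    filter_upwards [hkz] with y hy
    refine Subtype.ext ((hk'' y).trans ?_)
    rw [hy]

theorem isTorsor_trivial [DiffeologicalGroup G] : (trivial G B).IsTorsor where
  free x g h := by
    have : x.2 * g = x.2 := congrArg Prod.snd h
    simpa using this
  trans x y h := ⟨x.2⁻¹ * y.2, Prod.ext h (mul_inv_cancel_left _ _)⟩
  div n p q γ hp hq h := by
    have : γ = fun y => (p y).2⁻¹ * (q y).2 := funext fun y => by
      rw [← h y]
      exact (inv_mul_cancel_left _ _).symm
    rw [this]
    exact IsPlot.mul (IsPlot.inv hp.2) hq.2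
  lift n p hp z := ⟨fun y => (p y, 1), ⟨hp, isPlot_const⟩, Filter.Eventually.of_forall fun _ => rfl⟩

/-- A map to the group which is smooth and equivariant over `U`. -/
structure IsChart (P : GSpaceOver.{u, v, w} G B) (U : Set B) (ψ : P.Total → G) : Prop where
  equivariant : ∀ x g, P.proj x ∈ U → ψ (P.act x g) = ψ x * g
  smooth : ∀ (n : ℕ) (p : EuclideanSpace ℝ (Fin n) → P.Total), IsPlot p →
    (∀ y, P.proj (p y) ∈ U) → IsPlot fun y => ψ (p y)

/-- Projection and chart together form an equivariant map of torsors into the product, so no inverse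
has to be constructed. -/
theorem IsTorsor.restrict_isTrivial [DiffeologicalGroup G] {P : GSpaceOver.{u, v, w} G B}
    (hP : P.IsTorsor) {U : Set B} {ψ : P.Total → G} (hψ : P.IsChart U ψ) :
    (P.restrict U).IsTrivial := by
  refine Iso.of_isTorsor (P := P.restrict U) (Q := trivial G U) (hP.restrict U) isTorsor_trivial
    (fun x => (⟨P.proj x.1, x.2⟩, ψ x.1)) (fun n p hp => ⟨P.smooth_proj n _ hp,
      hψ.smooth n _ hp fun y => (p y).2⟩) (fun x => rfl) fun x g => ?_
  exact Prod.ext (Subtype.ext (P.proj_act _ _)) (hψ.equivariant _ _ x.2)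

theorem exists_isChart [DiffeologicalGroup G] {P : GSpaceOver.{u, v, w} G B} {U : Set B}
    (h : (P.restrict U).IsTrivial) : ∃ ψ, P.IsChart U ψ := by
  classical
  obtain ⟨e, h1, -, h3, h4⟩ := h
  refine ⟨fun x => if hx : P.proj x ∈ U then (e ⟨x, hx⟩).2 else 1, fun x g hx => ?_,
    fun n p hp hU => ?_⟩
  · have hx' : P.proj (P.act x g) ∈ U := by rwa [P.proj_act]
    simp only [dif_pos hx, dif_pos hx']
    exact congrArg Prod.snd (h4 ⟨x, hx⟩ g)
  · simp only [dif_pos (hU _)]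
    exact (h1 n (fun y => ⟨p y, hU y⟩) hp).2

/-- A bundle which is trivial over the members of a `D`-open cover is a torsor. -/
theorem isTorsor_of_cover [DiffeologicalGroup G] {P : GSpaceOver.{u, v, w} G B}
    (h : ∀ b, ∃ U : Set B, b ∈ U ∧ IsOpen[dTopology] U ∧ (P.restrict U).IsTrivial) :
    P.IsTorsor := by
  have key : ∀ b, ∃ U : Set B, b ∈ U ∧ IsOpen[dTopology] U ∧ (P.restrict U).IsTorsor :=
      fun b => by
    obtain ⟨U, hb, hU, ht⟩ := h b
    obtain ⟨e, h1, h2, h3, h4⟩ := ht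
    have hT : (trivial G U).IsTorsor := isTorsor_trivial
    refine ⟨U, hb, hU, ⟨fun x g hx => hT.free (e x) g ?_, fun x y hxy => ?_, fun n p q γ hp hq hγ =>
      hT.div n _ _ γ (h1 n p hp) (h1 n q hq) fun y => ?_, fun n p hp z => ?_⟩⟩
    · rw [← h4, hx]
    · obtain ⟨g, hg⟩ := hT.trans (e x) (e y) (by rw [h3, h3, hxy])
      exact ⟨g, e.injective (by rw [h4, hg])⟩
    · rw [Function.comp_apply, ← h4, hγ, Function.comp_apply]
    · obtain ⟨q, hq, hqz⟩ := hT.lift n p hp z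
      refine ⟨_, h2 n q hq, hqz.mono fun y hy => ?_⟩
      rw [← h3, Function.comp_apply, e.apply_symm_apply, hy]
  refine ⟨fun x g hx => ?_, fun x y hxy => ?_, fun n p q γ hp hq hγ => ?_, fun n p hp z => ?_⟩
  · obtain ⟨U, hb, -, hU⟩ := key (P.proj x)
    exact hU.free ⟨x, hb⟩ g (Subtype.ext hx)
  · obtain ⟨U, hb, -, hU⟩ := key (P.proj x)
    obtain ⟨g, hg⟩ := hU.trans ⟨x, hb⟩ ⟨y, hxy ▸ hb⟩ (Subtype.ext hxy)
    exact ⟨g, congrArg Subtype.val hg⟩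
  -- Division is local: where `p` stays over `U`, so does `q`, because the action preserves fibres.
  · refine isPlot_of_nhds fun z => ?_
    obtain ⟨U, hb, hU, hT⟩ := key (P.proj (p z))
    refine ⟨_, (isOpen_iff_preimages_plots.1 hU n _ (P.smooth_proj n p hp)).mem_nhds hb,
      fun m k hk hk' => ?_⟩
    have hk2 : ∀ y, P.proj (q (k y)) ∈ U := fun y => by
      rw [← hγ, P.proj_act]
      exact hk y
    exact hT.div m (fun y => ⟨p (k y), hk y⟩) (fun y => ⟨q (k y), hk2 y⟩) _ (isPlot_reparam hp hk')
      (isPlot_reparam hq hk') fun y => Subtype.ext (hγ (k y))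
  · obtain ⟨U, hb, hU, hT⟩ := key (p z)
    obtain ⟨k, hk, hk', hkz⟩ := exists_smooth_into_nhds
      ((isOpen_iff_preimages_plots.1 hU n p hp).mem_nhds hb)
    obtain ⟨q, hq, hqz⟩ := hT.lift n (fun y => ⟨p (k y), hk y⟩) (isPlot_reparam hp hk') z
    refine ⟨fun y => (q y).1, hq, ?_⟩
    filter_upwards [hkz, hqz] with y hy hy'
    exact (congrArg Subtype.val hy').trans (congrArg p hy)

/-- A local lift `q` of the plot is a local section of the pullback, and division by a section is a
chart. -/
theorem IsTorsor.isPrincipal [DiffeologicalGroup G] {P : GSpaceOver.{u, v, w} G B}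
    (hP : P.IsTorsor) : P.IsPrincipal := fun n p hp => by
  refine ⟨{V | IsOpen[dTopology] V ∧ ((P.pullback p hp.dSmooth).restrict V).IsTrivial},
    fun V hV => hV.1, ?_, fun V hV => hV.2⟩
  refine Set.eq_univ_of_forall fun z => ?_
  obtain ⟨q, hq, h⟩ := hP.lift n p hp z
  obtain ⟨V, hV, hVo, hz⟩ := eventually_nhds_iff.1 h
  have hT := hP.pullback hp.dSmooth
  have hex : ∀ x : (P.pullback p hp.dSmooth).Total, ∃ g, x.1.1 ∈ V → P.act (q x.1.1) g = x.1.2 :=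
    fun x => by
      by_cases hx : x.1.1 ∈ V
      · obtain ⟨g, hg⟩ := hP.trans (q x.1.1) x.1.2 ((hV _ hx).trans x.2)
        exact ⟨g, fun _ => hg⟩
      · exact ⟨1, fun h => absurd h hx⟩
  choose ψ hψ using hex
  refine ⟨V, ⟨isOpen_iff_preimages_plots.2 fun m r hr =>
    hVo.preimage (IsPlot.contDiff hr).continuous, hT.restrict_isTrivial (ψ := ψ) ⟨fun x g hx => ?_,
      fun m r hr hrV => ?_⟩⟩, hz⟩
  · refine hP.act_injective (q x.1.1) ?_
    rw [P.act_mul, hψ x hx]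
    exact hψ ((P.pullback p hp.dSmooth).act x g) hx
  · exact hP.div m (fun y => q (r y).1.1) (fun y => (r y).1.2) _
      (isPlot_reparam hq (IsPlot.contDiff hr.1)) hr.2 fun y => hψ _ (hrV y)

theorem IsDNumerablePrincipal.isTorsor [DiffeologicalGroup G] {P : GSpaceOver.{u, v, w} G B}
    (hP : P.IsDNumerablePrincipal) : P.IsTorsor := by
  obtain ⟨-, ι, μ, U, -, hU, hc, -, ht⟩ := hP
  refine isTorsor_of_cover fun b => ?_
  obtain ⟨i, hi⟩ := Set.mem_iUnion.1 (hc.symm ▸ Set.mem_univ b : b ∈ ⋃ i, U i)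
  exact ⟨U i, hi, hU i, ht i⟩

end GSpaceOver

/-! ### Locally finite sums and the simplex -/

theorem finsum_eq_sum_range {f : ℕ → ℝ} {N : ℕ} (h : ∀ i, N ≤ i → f i = 0) :
    ∑ᶠ i, f i = ∑ i ∈ Finset.range N, f i :=
  finsum_eq_finsetSum_of_support_subset f fun i hi => by
    by_contra hc
    exact hi (h i (by simpa using hc))

theorem contDiff_finsum_nat {E : Type u} [NormedAddCommGroup E] [NormedSpace ℝ E] {f : ℕ → E → ℝ}
    (hf : ∀ i, ContDiff ℝ ∞ (f i)) (h : ∀ z, ∃ N : ℕ, ∀ᶠ y in 𝓝 z, ∀ i, N ≤ i → f i y = 0) :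
    ContDiff ℝ ∞ fun y => ∑ᶠ i, f i y := by
  refine contDiff_iff_contDiffAt.2 fun z => ?_
  obtain ⟨N, hN⟩ := h z
  have hs : ContDiff ℝ ∞ fun y => ∑ i ∈ Finset.range N, f i y := ContDiff.sum fun i _ => hf i
  refine hs.contDiffAt.congr_of_eventuallyEq ?_
  filter_upwards [hN] with y hy
  exact finsum_eq_sum_range hy

theorem IsPlot.eventually_eq_zero {n : ℕ} {p : EuclideanSpace ℝ (Fin n) → Simplex}
    (hp : IsPlot p) (z : EuclideanSpace ℝ (Fin n)) :
    ∃ N : ℕ, ∀ᶠ y in 𝓝 z, ∀ i, N ≤ i → (p y).1 i = 0 := by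
  obtain ⟨N, hN⟩ := hp.2 z
  -- The diffeology speaks of indices `> N`; the shift turns this into `≥`, as needed for sums over
  -- `Finset.range`.
  exact ⟨N + 1, hN.mono fun y hy i hi => hy i hi⟩

theorem isPlot_simplex {n : ℕ} {p : EuclideanSpace ℝ (Fin n) → Simplex}
    (hp : ∀ i, ContDiff ℝ ∞ fun y => (p y).1 i)
    (h : ∀ z, ∃ N : ℕ, ∀ᶠ y in 𝓝 z, ∀ i, N ≤ i → (p y).1 i = 0) : IsPlot p :=
  ⟨fun i => (hp i).isPlot, fun z => by
    obtain ⟨N, hN⟩ := h z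
    exact ⟨N, hN.mono fun y hy i hi => hy i hi.le⟩⟩

namespace Simplex

theorem exists_eq_zero (t : Simplex) : ∃ N : ℕ, ∀ i, N ≤ i → t.1 i = 0 := by
  obtain ⟨N, hN⟩ := t.1.support.bddAbove
  refine ⟨N + 1, fun i hi => ?_⟩
  by_contra hc
  exact absurd (hN (Finsupp.mem_support_iff.2 hc)) (by lia)

theorem finsum_eq_one (t : Simplex) : ∑ᶠ i, t.1 i = 1 := by
  refine Eq.trans ?_ t.2.1
  exact finsum_eq_finsetSum_of_support_subset _ fun i hi => Finsupp.mem_support_iff.2 hi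

theorem nonneg (t : Simplex) (i : ℕ) : 0 ≤ t.1 i := t.2.2 i

theorem exists_ne_zero (t : Simplex) : ∃ i, t.1 i ≠ 0 := by
  by_contra! h
  have := t.finsum_eq_one
  simp [h] at this

theorem sum_le_one (t : Simplex) (s : Finset ℕ) : ∑ i ∈ s, t.1 i ≤ 1 := by
  calc ∑ i ∈ s, t.1 i ≤ ∑ i ∈ s ∪ t.1.support, t.1 i :=
        Finset.sum_le_sum_of_subset_of_nonneg Finset.subset_union_left fun i _ _ => t.nonneg i
    _ = ∑ i ∈ t.1.support, t.1 i :=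
        (Finset.sum_subset Finset.subset_union_right fun i _ hi => by simpa using hi).symm
    _ = 1 := t.2.1

theorem smooth_apply (i : ℕ) : DSmooth fun t : Simplex => t.1 i := fun _ _ hp => hp.1 i

/-- The sum of the squares of the coordinates. -/
def sq (t : Simplex) : ℝ := ∑ᶠ i, t.1 i ^ 2

theorem sq_smooth : DSmooth sq := fun n p hp => ContDiff.isPlot <|
  contDiff_finsum_nat (fun i => (IsPlot.contDiff (hp.1 i)).pow 2) fun z => by
    obtain ⟨N, hN⟩ := IsPlot.eventually_eq_zero hp z
    exact ⟨N, hN.mono fun y hy i hi => by simp [hy i hi]⟩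

theorem sq_pos (t : Simplex) : 0 < t.sq := by
  obtain ⟨N, hN⟩ := t.exists_eq_zero
  obtain ⟨i, hi⟩ := t.exists_ne_zero
  rw [sq, finsum_eq_sum_range (N := N) fun i hi => by simp [hN i hi]]
  refine Finset.sum_pos' (fun i _ => sq_nonneg _) ⟨i, ?_, by positivity⟩
  by_contra hc
  exact hi (hN i (by simpa using hc))

/-- The coordinates sum to 1, so the sum of squares is a weighted mean of the coordinates and cannot
exceed all of them doubled. Thus `sq / 2` is a smooth threshold which some coordinate always passes,
in place of the non-smooth half maximum. -/
theorem exists_sq_lt (t : Simplex) : ∃ i, t.sq / 2 < t.1 i := by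
  by_contra! h
  obtain ⟨N, hN⟩ := t.exists_eq_zero
  have h1 : t.sq ≤ t.sq / 2 := by
    calc t.sq = ∑ i ∈ Finset.range N, t.1 i ^ 2 :=
          finsum_eq_sum_range fun i hi => by simp [hN i hi]
      _ ≤ ∑ i ∈ Finset.range N, t.sq / 2 * t.1 i := Finset.sum_le_sum fun i _ => by
          rw [pow_two]
          exact mul_le_mul_of_nonneg_right (h i) (t.nonneg i)
      _ = t.sq / 2 := by
          rw [← Finset.mul_sum, ← finsum_eq_sum_range hN, t.finsum_eq_one, mul_one]
  linarith [t.sq_pos]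

end Simplex

/-- Non-negative, finitely supported families that are not zero. -/
structure IsWeight (a : ℕ → ℝ) : Prop where
  exists_eq_zero : ∃ N : ℕ, ∀ i, N ≤ i → a i = 0
  nonneg : ∀ i, 0 ≤ a i
  exists_pos : ∃ i, 0 < a i

theorem IsWeight.finsum_pos {a : ℕ → ℝ} (h : IsWeight a) : 0 < ∑ᶠ i, a i := by
  obtain ⟨N, hN⟩ := h.exists_eq_zero
  obtain ⟨i, hi⟩ := h.exists_pos
  rw [finsum_eq_sum_range hN]
  refine Finset.sum_pos' (fun i _ => h.nonneg i) ⟨i, ?_, hi⟩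
  by_contra hc
  exact hi.ne' (hN i (by simpa using hc))

theorem IsWeight.exists_simplex {a : ℕ → ℝ} (h : IsWeight a) :
    ∃ t : Simplex, ∀ i, t.1 i = a i / ∑ᶠ i, a i := by
  obtain ⟨N, hN⟩ := h.exists_eq_zero
  have hpos := h.finsum_pos
  refine ⟨⟨Finsupp.onFinset (Finset.range N) (fun i => a i / ∑ᶠ i, a i) fun i hi => ?_, ?_,
    fun i => div_nonneg (h.nonneg i) hpos.le⟩, fun i => rfl⟩
  · by_contra hc
    exact hi (by simp [hN i (by simpa using hc)])
  · rw [Finsupp.onFinset_sum _ fun _ => rfl, ← Finset.sum_div, ← finsum_eq_sum_range hN,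
      div_self hpos.ne']

open Classical in
/-- The point of the simplex proportional to a given family of weights. -/
def normalize (a : ℕ → ℝ) : Simplex :=
  -- The vertex 0 is an arbitrary value for families that cannot be normalized.
  if h : IsWeight a then h.exists_simplex.choose else ⟨Finsupp.single 0 1, by simp, fun i => by
    by_cases h : i = 0 <;> simp [h]⟩

theorem IsWeight.normalize_apply {a : ℕ → ℝ} (h : IsWeight a) (i : ℕ) :
    (normalize a).1 i = a i / ∑ᶠ i, a i := by
  rw [normalize, dif_pos h]
  exact h.exists_simplex.choose_spec i

theorem normalize_smooth {X : Type u} [DiffeologicalSpace X] {a : X → ℕ → ℝ}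
    (ha : ∀ x, IsWeight (a x)) (hs : ∀ i, DSmooth fun x => a x i)
    (h : ∀ (n : ℕ) (p : EuclideanSpace ℝ (Fin n) → X), IsPlot p → ∀ z,
      ∃ N : ℕ, ∀ᶠ y in 𝓝 z, ∀ i, N ≤ i → a (p y) i = 0) :
    DSmooth fun x => normalize (a x) := fun n p hp => by
  have hc : ∀ i, ContDiff ℝ ∞ fun y => a (p y) i := fun i => IsPlot.contDiff (hs i n p hp)
  refine isPlot_simplex (fun i => ?_) fun z => ?_
  · simp only [Function.comp_apply, (ha _).normalize_apply]
    exact (hc i).div (contDiff_finsum_nat hc (h n p hp)) fun y => (ha (p y)).finsum_pos.ne'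
  · obtain ⟨N, hN⟩ := h n p hp z
    exact ⟨N, hN.mono fun y hy i hi => by
      simp [(ha _).normalize_apply, hy i hi]⟩

namespace Simplex

/-- A smooth self-map of the simplex such that the supports of the coordinates of the image
form a locally finite family and are contained in the open sets where the coordinates of the
argument do not vanish. -/
def shrink (t : Simplex) : Simplex := normalize fun i => expNegInvGlue (t.1 i - t.sq / 2)

theorem isWeight_shrink (t : Simplex) : IsWeight fun i => expNegInvGlue (t.1 i - t.sq / 2) where
  exists_eq_zero := by
    obtain ⟨N, hN⟩ := t.exists_eq_zero
    exact ⟨N, fun i hi => expNegInvGlue.zero_of_nonpos (by linarith [hN i hi, t.sq_pos])⟩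
  nonneg i := expNegInvGlue.nonneg _
  exists_pos := by
    obtain ⟨i, hi⟩ := t.exists_sq_lt
    exact ⟨i, expNegInvGlue.pos_of_pos (by linarith)⟩

theorem shrink_smooth : DSmooth shrink := by
  refine normalize_smooth isWeight_shrink (fun i n p hp => ?_) fun n p hp z => ?_
  · exact ContDiff.isPlot (expNegInvGlue.contDiff.comp
      ((IsPlot.contDiff (hp.1 i)).sub ((IsPlot.contDiff (sq_smooth n p hp)).div_const 2)))
  · obtain ⟨N, hN⟩ := IsPlot.eventually_eq_zero hp z
    exact ⟨N, hN.mono fun y hy i hi =>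
      expNegInvGlue.zero_of_nonpos (by linarith [hy i hi, (p y).sq_pos])⟩

theorem lt_of_shrink_ne_zero {t : Simplex} {i : ℕ} (h : t.shrink.1 i ≠ 0) : t.sq / 2 < t.1 i := by
  by_contra! hc
  refine h ?_
  rw [shrink, t.isWeight_shrink.normalize_apply, expNegInvGlue.zero_of_nonpos (by linarith),
    zero_div]

theorem shrink_eq_zero {t : Simplex} {i : ℕ} (h : t.1 i ≤ t.sq / 2) : t.shrink.1 i = 0 := by
  by_contra hc
  exact absurd (lt_of_shrink_ne_zero hc) (not_lt.2 h)

theorem ne_zero_of_sq_le {t : Simplex} {i : ℕ} (h : t.sq / 2 ≤ t.1 i) : t.1 i ≠ 0 := by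
  have := t.sq_pos
  exact (by linarith : 0 < t.1 i).ne'

end Simplex

/-! ### The universal bundle as a torsor -/

namespace EG

variable {G : Type u}

/-- The coordinates `t_i` on `EG`. -/
def coord : EG G → Simplex := Quotient.lift Prod.fst fun _ _ h => h.1

theorem mk_eq_mk {t : Simplex} {g g' : ℕ → G} (h : ∀ i, t.1 i ≠ 0 → g i = g' i) :
    (Quotient.mk (eSetoid G) (t, g)) = Quotient.mk (eSetoid G) (t, g') :=
  Quotient.sound ⟨rfl, h⟩

variable [Group G]

open Classical in
/-- The group coordinate `g_i` on the part of `EG` where `t_i ≠ 0`. -/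
def chart (i : ℕ) : EG G → G :=
  -- The class determines `g_i` only where `t_i ≠ 0`; the constant default elsewhere makes the lift
  -- well defined.
  Quotient.lift (fun a => if a.1.1 i ≠ 0 then a.2 i else 1) fun a b h => by
    by_cases hi : a.1.1 i = 0
    · simp [hi, ← h.1]
    · have hi' : b.1.1 i ≠ 0 := h.1 ▸ hi
      simp [hi, hi', h.2 i hi]

theorem chart_mk {i : ℕ} {t : Simplex} {g : ℕ → G} (h : t.1 i ≠ 0) :
    chart i (Quotient.mk (eSetoid G) (t, g)) = g i := if_pos h

@[simp]
theorem coord_act (x : EG G) (g : G) : coord (act x g) = coord x :=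
  Quotient.inductionOn x fun _ => rfl

theorem act_mk (t : Simplex) (g : ℕ → G) (k : G) :
    act (Quotient.mk (eSetoid G) (t, g)) k = Quotient.mk (eSetoid G) (t, fun i => g i * k) := rfl

theorem chart_act {i : ℕ} {x : EG G} (h : (coord x).1 i ≠ 0) (k : G) :
    chart i (act x k) = chart i x * k := by
  induction x using Quotient.inductionOn with
  | h a =>
    have h' : a.1.1 i ≠ 0 := h
    rw [show (Quotient.mk _ a) = Quotient.mk (eSetoid G) (a.1, a.2) from rfl, act_mk, chart_mk h',
      chart_mk h']

end EG

/-- The coordinates `t_i` on `BG`. -/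
def BG.coord {G : Type u} [Group G] : BG G → Simplex :=
  Quotient.lift EG.coord fun x y h => by
    obtain ⟨g, rfl⟩ := h
    exact (EG.coord_act x g).symm

section

variable {G : Type u} [DiffeologicalSpace G]

theorem EG.coord_smooth : DSmooth (EG.coord : EG G → Simplex) := dSmooth_of_mk dSmooth_fst

/-- Maps to `EG` given by smooth simplex coordinates and by group coordinates which agree locally
with plots where they matter. -/
theorem EG.mk_smooth {X : Type v} [DiffeologicalSpace X] {τ : X → Simplex} (hτ : DSmooth τ)
    {γ : X → ℕ → G}
    (hγ : ∀ (i n : ℕ) (p : EuclideanSpace ℝ (Fin n) → X), IsPlot p → ∀ z,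
      ∃ q : EuclideanSpace ℝ (Fin n) → G, IsPlot q ∧
        ∀ᶠ y in 𝓝 z, (τ (p y)).1 i ≠ 0 → γ (p y) i = q y) :
    DSmooth fun x => (Quotient.mk (eSetoid G) (τ x, γ x) : EG G) := fun n p hp z => by
  choose q hq hqz using fun i => hγ i n p hp z
  -- Near `z` the group coordinates beyond `N` are irrelevant, so only finitely many neighbourhoods
  -- have to be intersected.
  obtain ⟨N, hN⟩ := IsPlot.eventually_eq_zero (hτ n p hp) z
  refine ⟨fun y => (τ (p y), fun i => q i y), ⟨hτ n p hp, hq⟩, ?_⟩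
  filter_upwards [hN, (Finset.range N).eventually_all.2 fun i _ => hqz i] with y h1 h2
  refine EG.mk_eq_mk fun i hi => ?_
  by_cases hiN : i < N
  · exact h2 i (Finset.mem_range.2 hiN) hi
  · exact absurd (h1 i (not_lt.1 hiN)) hi

variable [Group G]

theorem BG.coord_smooth : DSmooth (BG.coord : BG G → Simplex) := dSmooth_of_mk EG.coord_smooth

/-- A plot of `EG` composed with a group coordinate is a plot where that coordinate is defined. -/
theorem EG.chart_plot {i n : ℕ} {p : EuclideanSpace ℝ (Fin n) → EG G} (hp : IsPlot p)
    (h : ∀ y, (EG.coord (p y)).1 i ≠ 0) : IsPlot fun y => EG.chart i (p y) := by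
  refine isPlot_of_locally fun z => ?_
  obtain ⟨q, hq, hqz⟩ := hp z
  refine ⟨_, hq.2 i, hqz.mono fun y hy => ?_⟩
  have := h y
  rw [hy] at this ⊢
  exact EG.chart_mk this

variable [DiffeologicalGroup G]

/-- At every point some `t_i` is nonzero, and there `g_i` is an equivariant coordinate: it detects
freeness, and division is `g_i(p)⁻¹ g_i(q)` nearby. Lifting of plots is the definition of the
quotient diffeology. -/
theorem universalBundle_isTorsor : (universalBundle G).IsTorsor where
  free := fun x g h => by
    have h' : EG.act x g = x := h
    obtain ⟨i, hi⟩ := (EG.coord x).exists_ne_zero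
    have := EG.chart_act hi g
    rw [h'] at this
    simpa using this
  trans x y h := by
    obtain ⟨g, hg⟩ := Quotient.exact (s := bSetoid G) h
    exact ⟨g, hg.symm⟩
  div := fun n (p q : EuclideanSpace ℝ (Fin n) → EG G) γ (hp : IsPlot p) (hq : IsPlot q)
      (h' : ∀ y, EG.act (p y) (γ y) = q y) => by
    refine isPlot_of_nhds fun z => ?_
    obtain ⟨i, hi⟩ := (EG.coord (p z)).exists_ne_zero
    have hc : Continuous fun y => (EG.coord (p y)).1 i :=
      (IsPlot.contDiff ((EG.coord_smooth n p hp).1 i)).continuous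
    refine ⟨_, (isOpen_ne_fun hc continuous_const).mem_nhds hi, fun m k hk hk' => ?_⟩
    have hk2 : ∀ y, (EG.coord (p (k y))).1 i ≠ 0 := hk
    have : γ ∘ k = fun y => (EG.chart i (p (k y)))⁻¹ * EG.chart i (q (k y)) := funext fun y => by
      rw [← h', EG.chart_act (hk y), inv_mul_cancel_left, Function.comp_apply]
    rw [this]
    refine IsPlot.mul (IsPlot.inv (EG.chart_plot (isPlot_reparam hp hk') hk2))
      (EG.chart_plot (isPlot_reparam hq hk') fun y => ?_)
    rw [← h', EG.coord_act]
    exact hk y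
  lift n p hp z := by
    obtain ⟨q, hq, h⟩ := hp z
    exact ⟨q, hq, h.mono fun y hy => hy.symm⟩

theorem universalBundle_isChart (i : ℕ) :
    (universalBundle G).IsChart {b | (BG.coord b).1 i ≠ 0} (EG.chart i) :=
  ⟨fun _ g hx => EG.chart_act hx g, fun _ _ hp h => EG.chart_plot hp h⟩

end

/-! ### Countable numerations -/

namespace Simplex

/-- The coordinates of `shrink` along a smooth map to the simplex have supports in the open sets
where the original coordinates do not vanish. -/
theorem supp_shrink_subset {B : Type v} [DiffeologicalSpace B] {τ : B → Simplex}
    (hτ : DSmooth τ) (i : ℕ) :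
    supp (fun b => (τ b).shrink.1 i) ⊆ {b | (τ b).sq / 2 ≤ (τ b).1 i} := by
  have h1 : DSmooth fun b => (τ b).sq / 2 := fun n p hp =>
    ((IsPlot.contDiff (sq_smooth n _ (hτ n p hp))).div_const 2).isPlot
  let : TopologicalSpace B := dTopology
  refine closure_minimal (fun b hb => ?_)
    (isClosed_dTopology_le h1 ((smooth_apply i).comp hτ))
  exact (lt_of_shrink_ne_zero hb.ne').le

/-- If `t_i = 0` at `b` for `i ≥ N`, then near `b` the first `N` coordinates sum to more than `1 -
sq(b) / 4`, leaving less than `sq(b) / 4` for any other coordinate. Also `sq > sq(b) / 2` nearby, so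
such a coordinate is below the threshold `sq / 2` that holds on the support. -/
theorem locallyFinite_supp_shrink {B : Type v} [DiffeologicalSpace B] {τ : B → Simplex}
    (hτ : DSmooth τ) :
    @LocallyFinite ℕ B dTopology fun i => supp fun b => (τ b).shrink.1 i := by
  let : TopologicalSpace B := dTopology
  intro b
  obtain ⟨N, hN⟩ := (τ b).exists_eq_zero
  have hpos := (τ b).sq_pos
  have hS : DSmooth fun b => ∑ i ∈ Finset.range N, (τ b).1 i := fun n p hp =>
    (ContDiff.sum fun i _ => IsPlot.contDiff ((hτ n p hp).1 i)).isPlot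
  have h1 := isOpen_dTopology_lt (f := fun _ : B => (τ b).sq / 2) (g := fun b => (τ b).sq)
    dSmooth_const (sq_smooth.comp hτ)
  have h2 := isOpen_dTopology_lt (f := fun _ : B => 1 - (τ b).sq / 4) dSmooth_const hS
  refine ⟨_, (h1.inter h2).mem_nhds ⟨?_, ?_⟩, ?_⟩
  · change (τ b).sq / 2 < (τ b).sq
    linarith
  · change 1 - (τ b).sq / 4 < ∑ i ∈ Finset.range N, (τ b).1 i
    rw [← finsum_eq_sum_range hN, finsum_eq_one]
    linarith
  · refine (Finset.range N).finite_toSet.subset fun i hi => ?_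
    obtain ⟨c, hc, hc1, hc2⟩ := hi
    by_contra hiN
    have hiN' : i ∉ Finset.range N := hiN
    have h3 : (τ c).sq / 2 ≤ (τ c).1 i := supp_shrink_subset hτ i hc
    have h4 := (τ c).sum_le_one (insert i (Finset.range N))
    rw [Finset.sum_insert hiN'] at h4
    have h5 : (τ b).sq / 2 < (τ c).sq := hc1
    have h6 : 1 - (τ b).sq / 4 < ∑ i ∈ Finset.range N, (τ c).1 i := hc2
    linarith

end Simplex

namespace GSpaceOver

variable {G : Type u} [Group G] [DiffeologicalSpace G] {B : Type v} [DiffeologicalSpace B]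

/-- Simplex coordinates on the base together with charts over the sets where they do not
vanish. -/
structure IsNumeration (P : GSpaceOver.{u, v, w} G B) (τ : B → Simplex)
    (ψ : ℕ → P.Total → G) : Prop where
  smooth : DSmooth τ
  isChart : ∀ i, P.IsChart {b | (τ b).1 i ≠ 0} (ψ i)

theorem IsNumeration.isDNumerablePrincipal [DiffeologicalGroup G] {P : GSpaceOver.{u, v, w} G B}
    (hP : P.IsTorsor) {τ : B → Simplex} {ψ : ℕ → P.Total → G} (h : P.IsNumeration τ ψ) :
    P.IsDNumerablePrincipal := by
  -- The index type must live in the universe of `B`. The partition of unity is the shrunk family,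
  -- whose supports lie where the original coordinates are nonzero.
  refine ⟨hP.isPrincipal, ULift.{v} ℕ, fun i b => (τ b).shrink.1 i.down,
    fun i => {b | (τ b).1 i.down ≠ 0}, ⟨fun i => ?_, fun i b => Simplex.nonneg _ _, ?_, fun b => ?_⟩,
    fun i => ?_, ?_, fun i b hb => ?_, fun i => hP.restrict_isTrivial (h.isChart i.down)⟩
  · exact (Simplex.smooth_apply i.down).comp (Simplex.shrink_smooth.comp h.smooth)
  · exact @LocallyFinite.comp_injective _ _ _ dTopology _ (ULift.down : ULift.{v} ℕ → ℕ)
      (Simplex.locallyFinite_supp_shrink h.smooth) ULift.down_injective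
  · exact (finsum_comp_equiv Equiv.ulift (f := fun i => (τ b).shrink.1 i)).trans
      (τ b).shrink.finsum_eq_one
  · exact isOpen_dTopology_ne_zero ((Simplex.smooth_apply i.down).comp h.smooth)
  · refine Set.eq_univ_of_forall fun b => Set.mem_iUnion.2 ?_
    obtain ⟨i, hi⟩ := (τ b).exists_ne_zero
    exact ⟨⟨i⟩, hi⟩
  · exact Simplex.ne_zero_of_sq_le (Simplex.supp_shrink_subset h.smooth _ hb)

theorem IsNumeration.pullback {P : GSpaceOver.{u, v, w} G B} {τ : B → Simplex}
    {ψ : ℕ → P.Total → G} (h : P.IsNumeration τ ψ) {B' : Type v'} [DiffeologicalSpace B']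
    {f : B' → B} (hf : DSmooth f) :
    (P.pullback f hf).IsNumeration (fun b => τ (f b)) fun i x => ψ i x.1.2 where
  smooth := h.smooth.comp hf
  isChart i := by
    have key : ∀ x : (P.pullback f hf).Total, (τ (f x.1.1)).1 i ≠ 0 →
        P.proj x.1.2 ∈ {b | (τ b).1 i ≠ 0} := fun x hx => by rwa [← x.2]
    exact ⟨fun x g hx => (h.isChart i).equivariant x.1.2 g (key x hx),
      fun n p hp hU => (h.isChart i).smooth n _ hp.2 fun y => key _ (hU y)⟩

theorem universalBundle_isNumeration [DiffeologicalGroup G] :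
    (universalBundle G).IsNumeration BG.coord EG.chart :=
  ⟨BG.coord_smooth, universalBundle_isChart⟩

theorem isDNumerablePrincipal_pullback_universalBundle [DiffeologicalGroup G] {f : B → BG G}
    (hf : DSmooth f) : ((universalBundle G).pullback f hf).IsDNumerablePrincipal :=
  (universalBundle_isNumeration.pullback hf).isDNumerablePrincipal
    (universalBundle_isTorsor.pullback hf)

/-- A numeration yields a smooth equivariant map to the universal bundle. -/
theorem IsNumeration.exists_classifying {P : GSpaceOver.{u, v, w} G B} {τ : B → Simplex}
    {ψ : ℕ → P.Total → G} (h : P.IsNumeration τ ψ) :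
    ∃ Φ : P.Total → EG G, DSmooth Φ ∧ ∀ x g, Φ (P.act x g) = EG.act (Φ x) g := by
  refine ⟨fun x => Quotient.mk _ ((τ (P.proj x)).shrink, fun i => ψ i x), EG.mk_smooth
    (Simplex.shrink_smooth.comp (h.smooth.comp P.smooth_proj)) fun i n p hp z => ?_,
    fun x g => ?_⟩
  · have hτ : IsPlot fun y => τ (P.proj (p y)) := h.smooth n _ (P.smooth_proj n p hp)
    have hc : Continuous fun y => (τ (P.proj (p y))).1 i := (IsPlot.contDiff (hτ.1 i)).continuous
    -- Where `t_i` vanishes, the shrunk coordinate vanishes on a whole neighbourhood and any plot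
    -- will do; elsewhere the chart is smooth nearby.
    by_cases hz : (τ (P.proj (p z))).1 i = 0
    · have hs : Continuous fun y => (τ (P.proj (p y))).sq / 2 :=
        (IsPlot.contDiff (Simplex.sq_smooth n _ hτ)).continuous.div_const 2
      refine ⟨fun _ => 1, isPlot_const, ?_⟩
      have hlt : (τ (P.proj (p z))).1 i < (τ (P.proj (p z))).sq / 2 := by
        rw [hz]
        exact half_pos (Simplex.sq_pos _)
      filter_upwards [hc.continuousAt.eventually_lt hs.continuousAt hlt] with y hy hy'
      exact absurd (Simplex.shrink_eq_zero hy.le) hy'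
    · obtain ⟨k, hk, hk', hkz⟩ := exists_smooth_into_nhds
        ((isOpen_ne_fun hc continuous_const).mem_nhds hz)
      refine ⟨_, (h.isChart i).smooth n _ (isPlot_reparam hp hk') hk, ?_⟩
      filter_upwards [hkz] with y hy _
      rw [Function.comp_apply, hy]
  · simp only [P.proj_act]
    rw [EG.act_mk]
    refine EG.mk_eq_mk fun i hi => ?_
    exact (h.isChart i).equivariant x g
      (Simplex.ne_zero_of_sq_le (Simplex.lt_of_shrink_ne_zero hi).le)

end GSpaceOver

/-! ### From arbitrary to countable partitions of unity -/

section Countable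

variable {B : Type v} {ι : Type w} {μ : ι → B → ℝ}

/-- A function which is positive where `μ_i > ∑_{j ∉ S} μ_j` for all `i ∈ S`. -/
def bump (μ : ι → B → ℝ) (S : Finset ι) (b : B) : ℝ :=
  ∏ i ∈ S, expNegInvGlue (μ i b - (1 - ∑ j ∈ S, μ j b))

theorem bump_nonneg (S : Finset ι) (b : B) : 0 ≤ bump μ S b :=
  Finset.prod_nonneg fun _ _ => expNegInvGlue.nonneg _

theorem lt_of_bump_ne_zero {S : Finset ι} {b : B} (h : bump μ S b ≠ 0) {i : ι} (hi : i ∈ S) :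
    1 - ∑ j ∈ S, μ j b < μ i b := by
  by_contra! hc
  exact h (Finset.prod_eq_zero hi (expNegInvGlue.zero_of_nonpos (by linarith)))

namespace IsSmoothPartitionOfUnity

variable [DiffeologicalSpace B] (hμ : IsSmoothPartitionOfUnity μ)
include hμ

theorem finite_ne_zero (b : B) : {i | μ i b ≠ 0}.Finite := by
  by_contra h
  have h1 := hμ.sum_eq_one b
  rw [finsum_of_infinite_support h] at h1
  exact zero_ne_one h1

theorem sum_le_one (S : Finset ι) (b : B) : ∑ i ∈ S, μ i b ≤ 1 := by
  classical
  rw [← hμ.sum_eq_one b, finsum_eq_sum_of_support_subset (s := S ∪ (hμ.finite_ne_zero b).toFinset)]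
  · exact Finset.sum_le_sum_of_subset_of_nonneg Finset.subset_union_left fun i _ _ => hμ.nonneg i b
  · intro i hi
    simpa using Or.inr hi

theorem ne_zero_of_bump_ne_zero {S : Finset ι} {b : B} (h : bump μ S b ≠ 0) {i : ι}
    (hi : i ∈ S) : μ i b ≠ 0 := by
  have := lt_of_bump_ne_zero h hi
  have := hμ.sum_le_one S b
  exact (by linarith : 0 < μ i b).ne'

/-- For `i ∈ S \ T` and `j ∈ T \ S`, the first bump forces `μ_j ≤ 1 - ∑_S μ < μ_i` and the second
forces the opposite inequality. Equal cardinality provides both elements. -/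
theorem bump_unique {S T : Finset ι} (hST : S.card = T.card) {b : B} (hS : bump μ S b ≠ 0)
    (hT : bump μ T b ≠ 0) : S = T := by
  classical
  by_contra hne
  have h1 : ¬ S ⊆ T := fun h => hne (Finset.eq_of_subset_of_card_le h hST.ge)
  have h2 : ¬ T ⊆ S := fun h => hne (Finset.eq_of_subset_of_card_le h hST.le).symm
  obtain ⟨i, hiS, hiT⟩ := Finset.not_subset.1 h1
  obtain ⟨j, hjT, hjS⟩ := Finset.not_subset.1 h2
  have h3 := lt_of_bump_ne_zero hS hiS
  have h4 := lt_of_bump_ne_zero hT hjT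
  have h5 := hμ.sum_le_one (insert j S) b
  have h6 := hμ.sum_le_one (insert i T) b
  rw [Finset.sum_insert hjS] at h5
  rw [Finset.sum_insert hiT] at h6
  linarith

theorem bump_smooth (S : Finset ι) : DSmooth (bump μ S) := fun n p hp => by
  have hc : ∀ i, ContDiff ℝ ∞ fun y => μ i (p y) := fun i => IsPlot.contDiff (hμ.smooth i n p hp)
  exact (contDiff_prod fun i _ => expNegInvGlue.contDiff.comp
    ((hc i).sub (contDiff_const.sub (ContDiff.sum fun j _ => hc j)))).isPlot

theorem bump_pos (b : B) : 0 < bump μ (hμ.finite_ne_zero b).toFinset b := by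
  refine Finset.prod_pos fun i hi => expNegInvGlue.pos_of_pos ?_
  have h1 : ∑ j ∈ (hμ.finite_ne_zero b).toFinset, μ j b = 1 := by
    rw [← hμ.sum_eq_one b, finsum_eq_sum_of_support_subset]
    intro i hi
    simpa using hi
  have h2 : μ i b ≠ 0 := by simpa using hi
  have := lt_of_le_of_ne (hμ.nonneg i b) h2.symm
  linarith

/-- Local finiteness holds in the `D`-topology and pulls back along plots; it turns the sums over
`b`-dependent index sets into fixed finite sums near `z`. -/
theorem exists_finset {n : ℕ} {p : EuclideanSpace ℝ (Fin n) → B} (hp : IsPlot p)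
    (z : EuclideanSpace ℝ (Fin n)) :
    ∃ M : Finset ι, ∀ᶠ y in 𝓝 z, ∀ i, μ i (p y) ≠ 0 → i ∈ M := by
  let : TopologicalSpace B := dTopology
  obtain ⟨V, hV, hfin⟩ := hμ.locallyFinite (p z)
  obtain ⟨W, hWV, hW, hz⟩ := mem_nhds_iff.1 hV
  refine ⟨hfin.toFinset, ?_⟩
  filter_upwards [(isOpen_iff_preimages_plots.1 hW n p hp).mem_nhds hz] with y hy i hi
  rw [Set.Finite.mem_toFinset]
  exact ⟨p y, @subset_closure _ dTopology _ _ (lt_of_le_of_ne (hμ.nonneg i _) hi.symm), hWV hy⟩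

/-- The sum of the functions `bump μ S` over all `S` with `n + 1` elements. -/
def level (n : ℕ) (b : B) : ℝ :=
  ∑ S ∈ (hμ.finite_ne_zero b).toFinset.powersetCard (n + 1), bump μ S b

theorem level_eq {n : ℕ} {b : B} {M : Finset ι} (hM : ∀ i, μ i b ≠ 0 → i ∈ M) :
    hμ.level n b = ∑ S ∈ M.powersetCard (n + 1), bump μ S b := by
  refine Finset.sum_subset (Finset.powersetCard_mono fun i hi => hM i (by simpa using hi))
    fun S hS hS' => ?_
  by_contra hc
  refine hS' (Finset.mem_powersetCard.2 ⟨fun i hi => ?_, (Finset.mem_powersetCard.1 hS).2⟩)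
  simpa using hμ.ne_zero_of_bump_ne_zero hc hi

theorem level_smooth (n : ℕ) : DSmooth (hμ.level n) := fun m p hp => isPlot_of_locally fun z => by
  obtain ⟨M, hM⟩ := hμ.exists_finset hp z
  refine ⟨fun y => ∑ S ∈ M.powersetCard (n + 1), bump μ S (p y),
    (ContDiff.sum fun S _ => IsPlot.contDiff (hμ.bump_smooth S m p hp)).isPlot, ?_⟩
  filter_upwards [hM] with y hy
  exact hμ.level_eq hy

theorem exists_bump_of_level {n : ℕ} {b : B} (h : hμ.level n b ≠ 0) :
    ∃ S : Finset ι, S.card = n + 1 ∧ bump μ S b ≠ 0 := by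
  obtain ⟨S, hS, h⟩ := Finset.exists_ne_zero_of_sum_ne_zero h
  exact ⟨S, (Finset.mem_powersetCard.1 hS).2, h⟩

theorem level_eq_zero {n : ℕ} {b : B} {M : Finset ι} (hM : ∀ i, μ i b ≠ 0 → i ∈ M)
    (hn : M.card ≤ n) : hμ.level n b = 0 := by
  rw [hμ.level_eq hM, Finset.powersetCard_eq_empty.2 (by lia), Finset.sum_empty]

theorem isWeight_level (b : B) : IsWeight fun n => hμ.level n b where
  exists_eq_zero := ⟨(hμ.finite_ne_zero b).toFinset.card, fun n hn =>
    hμ.level_eq_zero (fun i hi => by simpa using hi) hn⟩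
  nonneg n := Finset.sum_nonneg fun S _ => bump_nonneg S b
  exists_pos := by
    have hne : (hμ.finite_ne_zero b).toFinset.card ≠ 0 := fun h => by
      have h1 := hμ.sum_eq_one b
      rw [Finset.card_eq_zero, Set.Finite.toFinset_eq_empty] at h
      have : (fun i => μ i b) = fun _ => 0 := funext fun i => by
        by_contra hi
        exact (h ▸ hi : i ∈ (∅ : Set ι))
      simp [this] at h1
    obtain ⟨n, hn⟩ := Nat.exists_eq_succ_of_ne_zero hne
    refine ⟨n, Finset.sum_pos' (fun S _ => bump_nonneg S b) ⟨_, ?_, hμ.bump_pos b⟩⟩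
    exact Finset.mem_powersetCard.2 ⟨subset_rfl, hn⟩

theorem level_normalize_smooth : DSmooth fun b => normalize fun n => hμ.level n b :=
  normalize_smooth hμ.isWeight_level hμ.level_smooth fun n p hp z => by
    obtain ⟨M, hM⟩ := hμ.exists_finset hp z
    exact ⟨M.card, hM.mono fun y hy i hi => hμ.level_eq_zero hy hi⟩

end IsSmoothPartitionOfUnity

-- Where `level n` is nonzero, exactly one `S` with `n + 1` elements has a nonzero bump, by
-- `bump_unique`. The sets `{bump μ S ≠ 0}` are `D`-open, disjoint for fixed cardinality, and
-- contained in `U i` for each `i ∈ S`. So choosing one `i ∈ S` for each `S` glues the charts of the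
-- `U i` to a single chart for the index `n`.
open Classical in
theorem GSpaceOver.IsDNumerablePrincipal.exists_isNumeration {G : Type u} [Group G]
    [DiffeologicalSpace G] [DiffeologicalGroup G] [DiffeologicalSpace B]
    {P : GSpaceOver.{u, v, w} G B} (hP : P.IsDNumerablePrincipal) : ∃ τ ψ, P.IsNumeration τ ψ := by
  obtain ⟨-, ι, μ, U, hμ, -, -, hs, ht⟩ := hP
  choose χ hχ using fun i => exists_isChart (ht i)
  have hU : ∀ {S : Finset ι} {b : B}, bump μ S b ≠ 0 → ∀ {i : ι}, i ∈ S → b ∈ U i :=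
    fun h i hi => hs i (@subset_closure _ dTopology _ _
      (lt_of_le_of_ne (hμ.nonneg i _) (hμ.ne_zero_of_bump_ne_zero h hi).symm))
  have hne : ∀ {S : Finset ι} {n : ℕ}, S.card = n + 1 → S.Nonempty := fun h =>
    Finset.card_pos.1 (by lia)
  let ψ : ℕ → P.Total → G := fun n x =>
    if h : ∃ S : Finset ι, S.card = n + 1 ∧ bump μ S (P.proj x) ≠ 0 then
      χ (hne h.choose_spec.1).choose x else 1
  have hψ : ∀ (n : ℕ) (S : Finset ι), S.card = n + 1 → ∃ i ∈ S, ∀ x, bump μ S (P.proj x) ≠ 0 →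
      ψ n x = χ i x := fun n S hS => by
    refine ⟨(hne hS).choose, (hne hS).choose_spec, fun x hx => ?_⟩
    have h : ∃ S : Finset ι, S.card = n + 1 ∧ bump μ S (P.proj x) ≠ 0 := ⟨S, hS, hx⟩
    have he : h.choose = S :=
      hμ.bump_unique (h.choose_spec.1.trans hS.symm) h.choose_spec.2 hx
    simp only [ψ, dif_pos h, he]
  have hlevel : ∀ {n : ℕ} {b : B}, (normalize fun n => hμ.level n b).1 n ≠ 0 →
      ∃ S : Finset ι, S.card = n + 1 ∧ bump μ S b ≠ 0 := fun {n b} h => by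
    refine hμ.exists_bump_of_level fun h0 => h ?_
    rw [(hμ.isWeight_level b).normalize_apply, h0, zero_div]
  refine ⟨_, ψ, hμ.level_normalize_smooth, fun n => ⟨fun x g hx => ?_, fun m p hp hp' => ?_⟩⟩
  · obtain ⟨S, hS, hb⟩ := hlevel hx
    obtain ⟨i, hi, hχi⟩ := hψ n S hS
    rw [hχi x hb, hχi _ (by rwa [P.proj_act]), (hχ i).equivariant _ _ (hU hb hi)]
  · refine isPlot_of_nhds fun z => ?_
    obtain ⟨S, hS, hb⟩ := hlevel (hp' z)
    obtain ⟨i, hi, hχi⟩ := hψ n S hS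
    refine ⟨_, (isOpen_iff_preimages_plots.1 (isOpen_dTopology_ne_zero (hμ.bump_smooth S)) m _
      (P.smooth_proj m p hp)).mem_nhds hb, fun l k hk hk' => ?_⟩
    have hk2 : ∀ y, bump μ S (P.proj (p (k y))) ≠ 0 := hk
    have : (fun y => ψ n (p y)) ∘ k = fun y => χ i (p (k y)) := funext fun y => hχi _ (hk2 y)
    rw [this]
    exact (hχ i).smooth l _ (isPlot_reparam hp hk') fun y => hU (hk2 y) hi

end Countable

/-! ### Classifying maps of equivariant maps -/

namespace GSpaceOver

variable {G : Type u} [Group G] [DiffeologicalSpace G]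
  {B : Type v} [DiffeologicalSpace B] {P : GSpaceOver.{u, v, w} G B}

/-- An equivariant map to `EG`, depending on a parameter, descends to the base. -/
theorem IsTorsor.exists_descend (hP : P.IsTorsor) {Z : Type v'} [DiffeologicalSpace Z]
    {K : P.Total × Z → EG G} (hK : DSmooth K)
    (hact : ∀ x g z, K (P.act x g, z) = EG.act (K (x, z)) g) :
    ∃ F : B × Z → BG G, DSmooth F ∧ ∀ x z, F (P.proj x, z) = Quotient.mk _ (K (x, z)) := by
  choose s hs using hP.surjective
  have key : ∀ x z, (Quotient.mk _ (K (s (P.proj x), z)) : BG G) = Quotient.mk _ (K (x, z)) :=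
    fun x z => by
      obtain ⟨g, hg⟩ := hP.trans (s (P.proj x)) x (hs _)
      exact Quotient.sound (s := bSetoid G) ⟨g, by rw [← hact, hg]⟩
  refine ⟨fun a => Quotient.mk _ (K (s a.1, a.2)), fun n p hp => isPlot_of_locally fun z => ?_, key⟩
  obtain ⟨q, hq, hqz⟩ := hP.lift n _ hp.1 z
  refine ⟨fun y => Quotient.mk _ (K (q y, (p y).2)),
    dSmooth_mk n _ (hK n (fun y => (q y, (p y).2)) ⟨hq, hp.2⟩), hqz.mono fun y hy => ?_⟩
  have h := key (q y) (p y).2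
  rw [hy] at h
  exact h

theorem IsTorsor.exists_classifying (hP : P.IsTorsor) {Φ : P.Total → EG G} (hΦ : DSmooth Φ)
    (hact : ∀ x g, Φ (P.act x g) = EG.act (Φ x) g) :
    ∃ f : SmoothMap B (BG G), ∀ x, f.toFun (P.proj x) = Quotient.mk _ (Φ x) := by
  obtain ⟨F, hF, h⟩ := hP.exists_descend (Z := ℝ) (hΦ.comp dSmooth_fst) fun x g _ => hact x g
  exact ⟨⟨fun b => F (b, 0), hF.comp (dSmooth_prodMk dSmooth_id dSmooth_const)⟩, fun x => h x 0⟩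

/-- The map `x ↦ (proj x, Φ x)` is equivariant between torsors over `B`. -/
theorem IsTorsor.iso_pullback [DiffeologicalGroup G] (hP : P.IsTorsor) {Φ : P.Total → EG G} (hΦ : DSmooth Φ)
    (hact : ∀ x g, Φ (P.act x g) = EG.act (Φ x) g) {f : SmoothMap B (BG G)}
    (hf : ∀ x, f.toFun (P.proj x) = Quotient.mk _ (Φ x)) :
    P.Iso ((universalBundle G).pullback f.toFun f.smooth) :=
  Iso.of_isTorsor (Q := (universalBundle G).pullback f.toFun f.smooth) hP
    (universalBundle_isTorsor.pullback f.smooth) (fun x => ⟨(P.proj x, Φ x), hf x⟩)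
    (fun n p hp => ⟨P.smooth_proj n p hp, hΦ n p hp⟩) (fun _ => rfl)
    fun x g => Subtype.ext (Prod.ext (P.proj_act x g) (hact x g))

theorem IsTorsor.homotopic (hP : P.IsTorsor) {K : P.Total × ℝ → EG G} (hK : DSmooth K)
    (hact : ∀ x g s, K (P.act x g, s) = EG.act (K (x, s)) g) {f₀ f₁ : SmoothMap B (BG G)}
    (h₀ : ∀ x, f₀.toFun (P.proj x) = Quotient.mk _ (K (x, 0)))
    (h₁ : ∀ x, f₁.toFun (P.proj x) = Quotient.mk _ (K (x, 1))) : f₀.Homotopic f₁ := by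
  obtain ⟨F, hF, h⟩ := hP.exists_descend hK hact
  refine ⟨F, hF, fun b => ?_, fun b => ?_⟩ <;> obtain ⟨x, rfl⟩ := hP.surjective b
  · rw [h, h₀]
  · rw [h, h₁]

end GSpaceOver

/-! ### Moving the coordinates of `EG` -/

theorem IsWeight.ne_zero_of_normalize {a : ℕ → ℝ} (h : IsWeight a) {i : ℕ}
    (hi : (normalize a).1 i ≠ 0) : a i ≠ 0 := fun h0 => hi (by rw [h.normalize_apply, h0, zero_div])

theorem Simplex.normalize_self (t : Simplex) (h : IsWeight fun i => t.1 i) :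
    normalize (fun i => t.1 i) = t :=
  Subtype.ext (Finsupp.ext fun i => by rw [h.normalize_apply, t.finsum_eq_one, div_one])

/-- Keeps relabelled families locally finite: a place of large index can only receive coordinates of
large index. -/
theorem exists_le_of_apply_eq (σ : ℕ → ℕ) (N : ℕ) :
    ∃ M, N ≤ M ∧ ∀ k, M ≤ k → ∀ i, σ i = k → N ≤ i := by
  -- This bound exceeds `σ i` for every `i < N`.
  refine ⟨N + ∑ i ∈ Finset.range N, (σ i + 1), by lia, fun k hk i hi => ?_⟩
  by_contra hc
  have := Finset.single_le_sum (f := fun i => σ i + 1) (fun i _ => Nat.zero_le _)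
    (Finset.mem_range.2 (not_le.1 hc))
  lia

theorem extend_eq_zero {σ : ℕ → ℕ} {a : ℕ → ℝ} {k : ℕ} (hσ : σ.Injective)
    (h : ∀ i, σ i = k → a i = 0) : Function.extend σ a 0 k = 0 := by
  by_cases hk : ∃ i, σ i = k
  · obtain ⟨i, rfl⟩ := hk
    rw [hσ.extend_apply, h i rfl]
  · rw [Function.extend_apply' _ _ _ hk, Pi.zero_apply]

theorem extend_nonneg {σ : ℕ → ℕ} {a : ℕ → ℝ} (hσ : σ.Injective) (ha : ∀ i, 0 ≤ a i) (k : ℕ) :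
    0 ≤ Function.extend σ a 0 k := by
  by_cases hk : ∃ i, σ i = k
  · obtain ⟨i, rfl⟩ := hk
    rw [hσ.extend_apply]
    exact ha i
  · rw [Function.extend_apply' _ _ _ hk, Pi.zero_apply]

theorem extend_plot {σ : ℕ → ℕ} (hσ : σ.Injective) {n : ℕ} {a : EuclideanSpace ℝ (Fin n) → ℕ → ℝ}
    (ha : ∀ i, ContDiff ℝ ∞ fun y => a y i) (k : ℕ) :
    ContDiff ℝ ∞ fun y => Function.extend σ (a y) 0 k := by
  by_cases hk : ∃ i, σ i = k
  · obtain ⟨i, rfl⟩ := hk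
    simpa only [hσ.extend_apply] using ha i
  · simpa only [Function.extend_apply' _ _ _ hk] using contDiff_const

theorem exists_ne_of_extend {σ : ℕ → ℕ} {a : ℕ → ℝ} {k : ℕ} (hσ : σ.Injective)
    (h : Function.extend σ a 0 k ≠ 0) : ∃ i, σ i = k ∧ a i ≠ 0 := by
  by_contra! hc
  exact h (extend_eq_zero hσ hc)

theorem isWeight_extend {σ : ℕ → ℕ} (hσ : σ.Injective) (t : Simplex) :
    IsWeight (Function.extend σ (fun i => t.1 i) 0) where
  exists_eq_zero := by
    obtain ⟨N, hN⟩ := t.exists_eq_zero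
    obtain ⟨M, -, hM⟩ := exists_le_of_apply_eq σ N
    exact ⟨M, fun k hk => extend_eq_zero hσ fun i hi => hN i (hM k hk i hi)⟩
  nonneg := extend_nonneg hσ t.nonneg
  exists_pos := by
    obtain ⟨i, hi⟩ := t.exists_ne_zero
    refine ⟨σ i, ?_⟩
    rw [hσ.extend_apply]
    exact lt_of_le_of_ne (t.nonneg i) hi.symm

/-- The relabelling of the coordinates of `EG` along an injection. -/
def EG.reindex {G : Type u} (σ : ℕ → ℕ) (hσ : σ.Injective) : EG G → EG G :=
  Quotient.map (fun a => (normalize (Function.extend σ (fun i => a.1.1 i) 0),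
    -- Off the range of `σ` the weight is zero, so the default is irrelevant for the class; taking
    -- `a.2` itself agrees with `slideElt` there.
    Function.extend σ a.2 a.2)) fun a b h => by
      refine ⟨by simp only [h.1], fun k hk => ?_⟩
      obtain ⟨i, rfl, hi⟩ := exists_ne_of_extend hσ ((isWeight_extend hσ a.1).ne_zero_of_normalize hk)
      simp only [hσ.extend_apply]
      exact h.2 i hi

/-- A smooth function which moves from `0` to `1` between `4⁻ⁱ / 2` and `4⁻ⁱ`. -/
def ramp (i : ℕ) (s : ℝ) : ℝ := Real.smoothTransition (2 * (4 ^ i * s) - 1)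

theorem ramp_smooth (i : ℕ) : ContDiff ℝ ∞ (ramp i) :=
  Real.smoothTransition.contDiff.comp
    ((contDiff_const.mul (contDiff_const.mul contDiff_id)).sub contDiff_const)

theorem ramp_nonneg (i : ℕ) (s : ℝ) : 0 ≤ ramp i s := Real.smoothTransition.nonneg _

theorem ramp_le_one (i : ℕ) (s : ℝ) : ramp i s ≤ 1 := Real.smoothTransition.le_one _

theorem ramp_eq_zero {i : ℕ} {s : ℝ} (h : 4 ^ i * s ≤ 1 / 2) : ramp i s = 0 :=
  Real.smoothTransition.zero_of_nonpos (by linarith)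

theorem ramp_eq_one {i : ℕ} {s : ℝ} (h : 1 ≤ 4 ^ i * s) : ramp i s = 1 :=
  Real.smoothTransition.one_of_one_le (by linarith)

/-- The factor 4 between consecutive times leaves a gap: as long as the ramp of a later index `k`
may be unfinished, the ramp of `i < k` has not begun. -/
theorem pow_mul_le {i k : ℕ} (hik : i < k) {s : ℝ} (h : 4 ^ k * s ≤ 1) : 4 ^ i * s ≤ 1 / 2 := by
  rcases le_or_gt s 0 with hs | hs
  · have := mul_nonpos_of_nonneg_of_nonpos (by positivity : (0 : ℝ) ≤ 4 ^ i) hs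
    linarith
  · have h1 : (4 : ℝ) ^ (i + 1) ≤ 4 ^ k := pow_le_pow_right₀ (by norm_num) hik
    have h2 := mul_le_mul_of_nonneg_right h1 hs.le
    rw [pow_succ] at h2
    nlinarith

/-- The weights of the homotopy that moves the `i`-th coordinate to the place `σ i`; the
coordinates of large index move first. -/
def slideWeight (σ : ℕ → ℕ) (t : Simplex) (s : ℝ) (k : ℕ) : ℝ :=
  (1 - ramp k s) * t.1 k + Function.extend σ (fun i => ramp i s * t.1 i) 0 k

section Slide

variable {σ : ℕ → ℕ} (hσ : σ.Injective)
include hσ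

theorem isWeight_slideWeight (t : Simplex) (s : ℝ) : IsWeight (slideWeight σ t s) where
  exists_eq_zero := by
    obtain ⟨N, hN⟩ := t.exists_eq_zero
    obtain ⟨M, hNM, hM⟩ := exists_le_of_apply_eq σ N
    refine ⟨M, fun k hk => ?_⟩
    rw [slideWeight, hN k (hNM.trans hk), extend_eq_zero hσ fun i hi => by rw [hN i (hM k hk i hi),
      mul_zero], mul_zero, zero_add]
  nonneg k := add_nonneg (mul_nonneg (by linarith [ramp_le_one k s]) (t.nonneg k))
    (extend_nonneg hσ (fun i => mul_nonneg (ramp_nonneg i s) (t.nonneg i)) k)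
  exists_pos := by
    obtain ⟨i, hi⟩ := t.exists_ne_zero
    have hi' : 0 < t.1 i := lt_of_le_of_ne (t.nonneg i) hi.symm
    have hn := extend_nonneg hσ fun i => mul_nonneg (ramp_nonneg i s) (t.nonneg i)
    rcases (ramp_le_one i s).lt_or_eq with h | h
    · exact ⟨i, add_pos_of_pos_of_nonneg (mul_pos (by linarith) hi') (hn i)⟩
    · refine ⟨σ i, add_pos_of_nonneg_of_pos (mul_nonneg (by linarith [ramp_le_one (σ i) s])
        (t.nonneg _)) ?_⟩
      rw [hσ.extend_apply, h, one_mul]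
      exact hi'

theorem normalize_slideWeight_smooth :
    DSmooth fun a : Simplex × ℝ => normalize (slideWeight σ a.1 a.2) := by
  refine normalize_smooth (fun a => isWeight_slideWeight hσ a.1 a.2) (fun k n p hp => ?_)
    fun n p hp z => ?_
  · have h1 : ∀ i, ContDiff ℝ ∞ fun y => (p y).1.1 i := fun i => IsPlot.contDiff (hp.1.1 i)
    have h2 : ∀ i, ContDiff ℝ ∞ fun y => ramp i (p y).2 := fun i =>
      (ramp_smooth i).comp (IsPlot.contDiff hp.2)
    exact (((contDiff_const.sub (h2 k)).mul (h1 k)).add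
      (extend_plot hσ (fun i => (h2 i).mul (h1 i)) k)).isPlot
  · obtain ⟨N, hN⟩ := IsPlot.eventually_eq_zero hp.1 z
    obtain ⟨M, hNM, hM⟩ := exists_le_of_apply_eq σ N
    refine ⟨M, hN.mono fun y hy k hk => ?_⟩
    rw [slideWeight, hy k (hNM.trans hk), extend_eq_zero hσ fun i hi => by rw [hy i (hM k hk i hi),
      mul_zero], mul_zero, zero_add]

end Slide

open Classical in
/-- The group coordinates of the homotopy that moves the `i`-th coordinate to the place `σ i`. -/
def slideElt {G : Type u} (σ : ℕ → ℕ) (g : ℕ → G) (s : ℝ) (k : ℕ) : G :=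
  if 4 ^ k * s ≤ 1 then g k else Function.extend σ g g k

section

variable {G : Type u} {σ : ℕ → ℕ} (hσ : σ.Injective) (hlt : ∀ i, i < σ i)
include hσ hlt

/-- Since `i < σ i`, up to time `4⁻ᵏ` nothing arrives at the place `k`, and afterwards nothing of
its own weight remains. So all its weight comes from a single source, and `slideElt` switches to the
group element of that source. -/
theorem slide_cases {t : Simplex} {s : ℝ} {k : ℕ} (h : slideWeight σ t s k ≠ 0) :
    (t.1 k ≠ 0 ∧ ∀ g : ℕ → G, slideElt σ g s k = g k) ∨
      ∃ i, σ i = k ∧ t.1 i ≠ 0 ∧ ∀ g : ℕ → G, slideElt σ g s k = g i := by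
  by_cases hs : 4 ^ k * s ≤ 1
  · refine Or.inl ⟨fun h0 => h ?_, fun g => if_pos hs⟩
    rw [slideWeight, h0, mul_zero, zero_add]
    refine extend_eq_zero hσ fun i hi => ?_
    rw [ramp_eq_zero (pow_mul_le (hi ▸ hlt i) hs), zero_mul]
  · rw [slideWeight, ramp_eq_one (not_le.1 hs).le, sub_self, zero_mul, zero_add] at h
    obtain ⟨i, rfl, hi⟩ := exists_ne_of_extend hσ h
    exact Or.inr ⟨i, rfl, fun h0 => hi (by rw [h0, mul_zero]), fun g => by
      rw [slideElt, if_neg hs, hσ.extend_apply]⟩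

/-- For `k = σ i` the switch at time `4⁻ᵏ` falls in the interval between `4⁻ᵏ` and `4⁻ⁱ / 2` where
the place `k` is empty. The jump is therefore invisible: before `4⁻ⁱ / 2` the old element is correct
wherever there is weight, from then on the new one. If `k` is not in the range, nothing switches. -/
theorem slideElt_plot [DiffeologicalSpace G] {n : ℕ}
    {p : EuclideanSpace ℝ (Fin n) → (Simplex × (ℕ → G)) × ℝ} (hp : IsPlot p)
    (z : EuclideanSpace ℝ (Fin n)) (k : ℕ) :
    ∃ q : EuclideanSpace ℝ (Fin n) → G, IsPlot q ∧ ∀ᶠ y in 𝓝 z,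
      slideWeight σ (p y).1.1 (p y).2 k ≠ 0 → slideElt σ (p y).1.2 (p y).2 k = q y := by
  have hc : Continuous fun y => (p y).2 := (IsPlot.contDiff hp.2).continuous
  by_cases hk : ∃ i, σ i = k
  · obtain ⟨i, rfl⟩ := hk
    rcases lt_or_ge (4 ^ i * (p z).2) (1 / 2) with h | h
    · refine ⟨_, hp.1.2 (σ i), ?_⟩
      filter_upwards [(continuous_const.mul hc).continuousAt.eventually_lt continuousAt_const h]
        with y hy hw
      by_cases hs : 4 ^ (σ i) * (p y).2 ≤ 1
      · exact if_pos hs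
      · rw [slideWeight, ramp_eq_one (not_le.1 hs).le, hσ.extend_apply, ramp_eq_zero hy.le] at hw
        simp at hw
    · refine ⟨_, hp.1.2 i, ?_⟩
      have h' : 1 < 4 ^ (σ i) * (p z).2 := by
        by_contra! hc
        have h1 := pow_mul_le (hlt i) hc
        have hs : 0 < (p z).2 := by
          by_contra! h0
          have := mul_nonpos_of_nonneg_of_nonpos (by positivity : (0 : ℝ) ≤ 4 ^ i) h0
          linarith
        have h2 : (4 : ℝ) ^ (i + 1) ≤ 4 ^ (σ i) := pow_le_pow_right₀ (by norm_num) (hlt i)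
        have h3 := mul_le_mul_of_nonneg_right h2 hs.le
        rw [pow_succ] at h3
        linarith
      filter_upwards [continuousAt_const.eventually_lt (continuous_const.mul hc).continuousAt h']
        with y hy _
      have hy' : 1 < 4 ^ (σ i) * (p y).2 := hy
      rw [slideElt, if_neg (not_le.2 hy'), hσ.extend_apply]
  · refine ⟨_, hp.1.2 k, Filter.Eventually.of_forall fun y _ => ?_⟩
    rw [slideElt, Function.extend_apply' _ _ _ hk, ite_self]

end

namespace EG

variable {G : Type u}

/-- A homotopy from the identity of `EG` to a relabelling of the coordinates. -/
def slide (σ : ℕ → ℕ) (hσ : σ.Injective) (hlt : ∀ i, i < σ i) (x : EG G) (s : ℝ) : EG G :=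
  Quotient.map (fun a => (normalize (slideWeight σ a.1 s), slideElt σ a.2 s)) (fun a b h => by
    refine ⟨by simp only [h.1], fun k hk => ?_⟩
    rcases slide_cases (G := G) hσ hlt ((isWeight_slideWeight hσ a.1 s).ne_zero_of_normalize hk) with
      ⟨h0, hg⟩ | ⟨i, -, h0, hg⟩
    · simp only [hg]
      exact h.2 k h0
    · simp only [hg]
      exact h.2 i h0) x

variable {σ : ℕ → ℕ} (hσ : σ.Injective) (hlt : ∀ i, i < σ i)

theorem slide_zero (x : EG G) : slide σ hσ hlt x 0 = x := by
  induction x using Quotient.inductionOn with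
  | h a =>
    have hw : slideWeight σ a.1 0 = fun i => a.1.1 i := funext fun k => by
      have h0 : ∀ i, ramp i 0 = 0 := fun i => ramp_eq_zero (by simp)
      rw [slideWeight, extend_eq_zero hσ fun i _ => by rw [h0, zero_mul]]
      simp [h0]
    have h1 := isWeight_slideWeight hσ a.1 0
    rw [hw] at h1
    refine congrArg (Quotient.mk (eSetoid G)) (Prod.ext ?_ (funext fun k => ?_))
    · change normalize (slideWeight σ a.1 0) = a.1
      rw [hw, Simplex.normalize_self _ h1]
    · exact if_pos (by simp)

theorem slide_one (x : EG G) : slide σ hσ hlt x 1 = reindex σ hσ x := by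
  induction x using Quotient.inductionOn with
  | h a =>
    have hw : slideWeight σ a.1 1 = Function.extend σ (fun i => a.1.1 i) 0 := funext fun k => by
      have h1 : ∀ i, ramp i 1 = 1 := fun i =>
        ramp_eq_one (by rw [mul_one]; exact one_le_pow₀ (by norm_num))
      simp [slideWeight, h1]
    refine congrArg (Quotient.mk (eSetoid G)) (Prod.ext ?_ (funext fun k => ?_))
    · exact congrArg normalize hw
    · change slideElt σ a.2 1 k = Function.extend σ a.2 a.2 k
      rw [slideElt]
      split_ifs with h
      -- At time 1 only the place 0 has not switched, and it is not in the range of `σ` because `i <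
      -- σ i`.
      · have hk : ¬ ∃ i, σ i = k := fun ⟨i, hi⟩ => by
          have h2 := pow_mul_le (hi ▸ hlt i) h
          have h3 : (1 : ℝ) ≤ 4 ^ i := one_le_pow₀ (by norm_num)
          linarith
        rw [Function.extend_apply' _ _ _ hk]
      · rfl

theorem slide_act [Group G] (x : EG G) (g : G) (s : ℝ) :
    slide σ hσ hlt (act x g) s = act (slide σ hσ hlt x s) g := by
  induction x using Quotient.inductionOn with
  | h a =>
    refine mk_eq_mk fun k hk => ?_
    rcases slide_cases (G := G) hσ hlt ((isWeight_slideWeight hσ a.1 s).ne_zero_of_normalize hk) with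
      ⟨-, hg⟩ | ⟨i, -, -, hg⟩ <;> simp only [hg]

theorem slide_smooth [DiffeologicalSpace G] :
    DSmooth fun a : EG G × ℝ => slide σ hσ hlt a.1 a.2 := by
  refine dSmooth_of_mk_prod (mk_smooth (τ := fun a : (Simplex × (ℕ → G)) × ℝ =>
    normalize (slideWeight σ a.1.1 a.2)) (γ := fun a => slideElt σ a.1.2 a.2) ?_ ?_)
  · exact fun n p hp => normalize_slideWeight_smooth hσ n (fun y => ((p y).1.1, (p y).2))
      ⟨hp.1.1, hp.2⟩
  · intro k n p hp z
    obtain ⟨q, hq, h⟩ := slideElt_plot hσ hlt hp z k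
    exact ⟨q, hq, h.mono fun y hy hk =>
      hy ((isWeight_slideWeight hσ _ _).ne_zero_of_normalize hk)⟩

end EG

/-! ### Joining two relabelled points -/

/-- The weights of the homotopy between two relabellings with disjoint ranges. -/
def joinWeight (σ ρ : ℕ → ℕ) (t t' : Simplex) (s : ℝ) (k : ℕ) : ℝ :=
  (1 - Real.smoothTransition s) * Function.extend σ (fun i => t.1 i) 0 k +
    Real.smoothTransition s * Function.extend ρ (fun i => t'.1 i) 0 k

section

variable {σ ρ : ℕ → ℕ} (hσ : σ.Injective) (hρ : ρ.Injective)
include hσ hρ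

theorem isWeight_joinWeight (t t' : Simplex) (s : ℝ) : IsWeight (joinWeight σ ρ t t' s) where
  exists_eq_zero := by
    obtain ⟨M, hM⟩ := (isWeight_extend hσ t).exists_eq_zero
    obtain ⟨N, hN⟩ := (isWeight_extend hρ t').exists_eq_zero
    exact ⟨max M N, fun k hk => by
      rw [joinWeight, hM k (le_of_max_le_left hk), hN k (le_of_max_le_right hk), mul_zero, mul_zero,
        zero_add]⟩
  nonneg k := add_nonneg (mul_nonneg (by linarith [Real.smoothTransition.le_one s])
    ((isWeight_extend hσ t).nonneg k)) (mul_nonneg (Real.smoothTransition.nonneg s)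
    ((isWeight_extend hρ t').nonneg k))
  exists_pos := by
    obtain ⟨i, hi⟩ := (isWeight_extend hσ t).exists_pos
    obtain ⟨j, hj⟩ := (isWeight_extend hρ t').exists_pos
    have h0 := Real.smoothTransition.nonneg s
    rcases (Real.smoothTransition.le_one s).lt_or_eq with h | h
    · exact ⟨i, add_pos_of_pos_of_nonneg (mul_pos (by linarith) hi)
        (mul_nonneg h0 ((isWeight_extend hρ t').nonneg i))⟩
    · exact ⟨j, add_pos_of_nonneg_of_pos (mul_nonneg (by linarith)
        ((isWeight_extend hσ t).nonneg j)) (by rwa [h, one_mul])⟩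

theorem normalize_joinWeight_smooth : DSmooth fun a : (Simplex × Simplex) × ℝ =>
    normalize (joinWeight σ ρ a.1.1 a.1.2 a.2) := by
  refine normalize_smooth (fun a => isWeight_joinWeight hσ hρ a.1.1 a.1.2 a.2)
    (fun k n p hp => ?_) fun n p hp z => ?_
  · have h : ContDiff ℝ ∞ fun y => Real.smoothTransition (p y).2 :=
      Real.smoothTransition.contDiff.comp (IsPlot.contDiff hp.2)
    exact (((contDiff_const.sub h).mul (extend_plot hσ
      (fun i => IsPlot.contDiff (hp.1.1.1 i)) k)).add (h.mul (extend_plot hρ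
      (fun i => IsPlot.contDiff (hp.1.2.1 i)) k))).isPlot
  · obtain ⟨N₁, hN₁⟩ := IsPlot.eventually_eq_zero hp.1.1 z
    obtain ⟨N₂, hN₂⟩ := IsPlot.eventually_eq_zero hp.1.2 z
    obtain ⟨M₁, -, hM₁⟩ := exists_le_of_apply_eq σ N₁
    obtain ⟨M₂, -, hM₂⟩ := exists_le_of_apply_eq ρ N₂
    refine ⟨max M₁ M₂, ?_⟩
    filter_upwards [hN₁, hN₂] with y h₁ h₂ k hk
    rw [joinWeight,
      extend_eq_zero hσ fun i hi => h₁ i (hM₁ k (le_of_max_le_left hk) i hi),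
      extend_eq_zero hρ fun i hi => h₂ i (hM₂ k (le_of_max_le_right hk) i hi), mul_zero, mul_zero,
      zero_add]

end

/-- The group coordinates of the homotopy between two relabellings with disjoint ranges. -/
def joinElt {G : Type u} [One G] (σ ρ : ℕ → ℕ) (g g' : ℕ → G) : ℕ → G :=
  Function.extend σ g (Function.extend ρ g' 1)

section

variable {G : Type u} [Group G] {σ ρ : ℕ → ℕ} (hσ : σ.Injective) (hρ : ρ.Injective)
  (hσρ : ∀ i j, σ i ≠ ρ j)
include hρ hσρ

theorem joinElt_right (g g' : ℕ → G) (j : ℕ) : joinElt σ ρ g g' (ρ j) = g' j := by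
  rw [joinElt, Function.extend_apply' _ _ _ fun ⟨i, hi⟩ => hσρ i j hi, hρ.extend_apply]

include hσ

/-- The ranges are disjoint, so each place belongs to at most one of the two points. The group
coordinates can then stay fixed while only the weights move. -/
theorem join_cases {t t' : Simplex} {s : ℝ} {k : ℕ} (h : joinWeight σ ρ t t' s k ≠ 0) :
    (∃ i, t.1 i ≠ 0 ∧ ∀ g g' : ℕ → G, joinElt σ ρ g g' k = g i) ∨
      ∃ j, t'.1 j ≠ 0 ∧ ∀ g g' : ℕ → G, joinElt σ ρ g g' k = g' j := by
  by_cases h1 : Function.extend σ (fun i => t.1 i) 0 k = 0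
  · rw [joinWeight, h1, mul_zero, zero_add] at h
    obtain ⟨j, rfl, hj⟩ := exists_ne_of_extend hρ (right_ne_zero_of_mul h)
    exact Or.inr ⟨j, hj, fun g g' => joinElt_right hρ hσρ g g' j⟩
  · obtain ⟨i, rfl, hi⟩ := exists_ne_of_extend hσ h1
    exact Or.inl ⟨i, hi, fun g g' => hσ.extend_apply _ _ _⟩

end

namespace EG

variable {G : Type u} [Group G] {σ ρ : ℕ → ℕ} (hσ : σ.Injective) (hρ : ρ.Injective)
  (hσρ : ∀ i j, σ i ≠ ρ j)

/-- The homotopy between two relabellings with disjoint ranges. -/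
def join (σ ρ : ℕ → ℕ) (hσ : σ.Injective) (hρ : ρ.Injective) (hσρ : ∀ i j, σ i ≠ ρ j)
    (x y : EG G) (s : ℝ) : EG G :=
  Quotient.map₂ (fun a b => (normalize (joinWeight σ ρ a.1 b.1 s), joinElt σ ρ a.2 b.2))
    (fun a a' h b b' h' => by
      refine ⟨by simp only [h.1, h'.1], fun k hk => ?_⟩
      rcases join_cases (G := G) hσ hρ hσρ
        ((isWeight_joinWeight hσ hρ a.1 b.1 s).ne_zero_of_normalize hk) with
        ⟨i, h0, hg⟩ | ⟨i, h0, hg⟩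
      · simp only [hg]
        exact h.2 i h0
      · simp only [hg]
        exact h'.2 i h0) x y

theorem join_zero (x y : EG G) : join σ ρ hσ hρ hσρ x y 0 = reindex σ hσ x := by
  induction x, y using Quotient.inductionOn₂ with
  | h a b =>
    have hw : joinWeight σ ρ a.1 b.1 0 = Function.extend σ (fun i => a.1.1 i) 0 :=
      funext fun k => by simp [joinWeight]
    refine Quotient.sound ⟨congrArg normalize hw, fun k hk => ?_⟩
    have h := (isWeight_joinWeight hσ hρ a.1 b.1 0).ne_zero_of_normalize hk
    rw [hw] at h
    obtain ⟨i, rfl, -⟩ := exists_ne_of_extend hσ h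
    simp only [joinElt, hσ.extend_apply]

theorem join_one (x y : EG G) : join σ ρ hσ hρ hσρ x y 1 = reindex ρ hρ y := by
  induction x, y using Quotient.inductionOn₂ with
  | h a b =>
    have hw : joinWeight σ ρ a.1 b.1 1 = Function.extend ρ (fun i => b.1.1 i) 0 :=
      funext fun k => by simp [joinWeight]
    refine Quotient.sound ⟨congrArg normalize hw, fun k hk => ?_⟩
    have h := (isWeight_joinWeight hσ hρ a.1 b.1 1).ne_zero_of_normalize hk
    rw [hw] at h
    obtain ⟨i, rfl, -⟩ := exists_ne_of_extend hρ h
    simp only [joinElt_right hρ hσρ, hρ.extend_apply]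

theorem join_act (x y : EG G) (g : G) (s : ℝ) :
    join σ ρ hσ hρ hσρ (act x g) (act y g) s = act (join σ ρ hσ hρ hσρ x y s) g := by
  induction x, y using Quotient.inductionOn₂ with
  | h a b =>
    refine mk_eq_mk fun k hk => ?_
    rcases join_cases (G := G) hσ hρ hσρ
      ((isWeight_joinWeight hσ hρ a.1 b.1 s).ne_zero_of_normalize hk) with
      ⟨i, -, hg⟩ | ⟨i, -, hg⟩ <;> simp only [hg]

theorem join_smooth [DiffeologicalSpace G] :
    DSmooth fun a : (EG G × EG G) × ℝ => join σ ρ hσ hρ hσρ a.1.1 a.1.2 a.2 := by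
  have key : DSmooth fun a : ((Simplex × (ℕ → G)) × (Simplex × (ℕ → G))) × ℝ =>
      (Quotient.mk (eSetoid G) (normalize (joinWeight σ ρ a.1.1.1 a.1.2.1 a.2),
        joinElt σ ρ a.1.1.2 a.1.2.2)) := by
    intro n p hp
    refine dSmooth_mk n (fun y => (normalize (joinWeight σ ρ (p y).1.1.1 (p y).1.2.1 (p y).2),
      joinElt σ ρ (p y).1.1.2 (p y).1.2.2)) ⟨normalize_joinWeight_smooth hσ hρ n
      (fun y => (((p y).1.1.1, (p y).1.2.1), (p y).2)) ⟨⟨hp.1.1.1, hp.1.2.1⟩, hp.2⟩, fun k => ?_⟩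
    by_cases hk : ∃ i, σ i = k
    · obtain ⟨i, rfl⟩ := hk
      simpa only [joinElt, hσ.extend_apply] using hp.1.1.2 i
    · by_cases hk' : ∃ i, ρ i = k
      · obtain ⟨i, rfl⟩ := hk'
        simpa only [joinElt_right hρ hσρ] using hp.1.2.2 i
      · simpa only [joinElt, Function.extend_apply' _ _ _ hk,
          Function.extend_apply' _ _ _ hk'] using isPlot_const
  intro n p hp
  refine isPlot_of_locally fun z => ?_
  obtain ⟨q₁, hq₁, h₁⟩ := hp.1.1 z
  obtain ⟨q₂, hq₂, h₂⟩ := hp.1.2 z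
  refine ⟨_, key n (fun y => ((q₁ y, q₂ y), (p y).2)) ⟨⟨hq₁, hq₂⟩, hp.2⟩, ?_⟩
  filter_upwards [h₁, h₂] with y hy₁ hy₂
  rw [Function.comp_apply, hy₁, hy₂]
  rfl

end EG

/-! ### Uniqueness of classifying maps up to homotopy -/

namespace GSpaceOver

variable {G : Type u} [Group G] [DiffeologicalSpace G]
  {B : Type v} [DiffeologicalSpace B] {P : GSpaceOver.{u, v, w} G B}

/-- Relabelling the coordinates does not change the homotopy class of a classifying map. -/
theorem IsTorsor.exists_homotopic_reindex (hP : P.IsTorsor) {Φ : P.Total → EG G} (hΦ : DSmooth Φ)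
    (hact : ∀ x g, Φ (P.act x g) = EG.act (Φ x) g) {f : SmoothMap B (BG G)}
    (h : ∀ x, f.toFun (P.proj x) = Quotient.mk _ (Φ x)) {σ : ℕ → ℕ} (hσ : σ.Injective)
    (hlt : ∀ i, i < σ i) :
    ∃ k : SmoothMap B (BG G), f.Homotopic k ∧
      ∀ x, k.toFun (P.proj x) = Quotient.mk _ (EG.reindex σ hσ (Φ x)) := by
  have hK : DSmooth fun a : P.Total × ℝ => EG.slide σ hσ hlt (Φ a.1) a.2 := fun n p hp =>
    EG.slide_smooth hσ hlt n (fun y => (Φ (p y).1, (p y).2)) ⟨hΦ n _ hp.1, hp.2⟩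
  have hact' : ∀ x g s, EG.slide σ hσ hlt (Φ (P.act x g)) s =
      EG.act (EG.slide σ hσ hlt (Φ x) s) g := fun x g s => by rw [hact, EG.slide_act]
  have hK1 : DSmooth fun x : P.Total => EG.slide σ hσ hlt (Φ x) 1 := fun n p hp =>
    hK n (fun y => (p y, 1)) ⟨hp, isPlot_const⟩
  obtain ⟨k, hk⟩ := hP.exists_classifying hK1 fun x g => hact' x g 1
  refine ⟨k, hP.homotopic hK hact' (fun x => ?_) hk, fun x => ?_⟩
  · rw [h, EG.slide_zero]
  · rw [hk, EG.slide_one]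

/-- Any two equivariant maps from a torsor to the universal bundle induce homotopic maps. -/
theorem IsTorsor.homotopic_of_classifying (hP : P.IsTorsor) {Φ₀ Φ₁ : P.Total → EG G}
    (hΦ₀ : DSmooth Φ₀) (hΦ₁ : DSmooth Φ₁) (hact₀ : ∀ x g, Φ₀ (P.act x g) = EG.act (Φ₀ x) g)
    (hact₁ : ∀ x g, Φ₁ (P.act x g) = EG.act (Φ₁ x) g) {f₀ f₁ : SmoothMap B (BG G)}
    (h₀ : ∀ x, f₀.toFun (P.proj x) = Quotient.mk _ (Φ₀ x))
    (h₁ : ∀ x, f₁.toFun (P.proj x) = Quotient.mk _ (Φ₁ x)) : f₀.Homotopic f₁ := by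
  -- Odd and positive even places are disjoint; the summands 1 and 2 ensure that every index
  -- strictly increases, as `EG.slide` requires.
  obtain ⟨σ, hσ, hσl, ρ, hρ, hρl, hσρ⟩ : ∃ σ : ℕ → ℕ, σ.Injective ∧ (∀ i, i < σ i) ∧
      ∃ ρ : ℕ → ℕ, ρ.Injective ∧ (∀ i, i < ρ i) ∧ ∀ i j, σ i ≠ ρ j :=
    ⟨fun i => 2 * i + 1, fun i j h => by simpa using h, fun i => by lia,
      fun i => 2 * i + 2, fun i j h => by simpa using h, fun i => by lia, fun i j => by lia⟩
  obtain ⟨k₀, e₀, hk₀⟩ := hP.exists_homotopic_reindex hΦ₀ hact₀ h₀ hσ hσl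
  obtain ⟨k₁, e₁, hk₁⟩ := hP.exists_homotopic_reindex hΦ₁ hact₁ h₁ hρ hρl
  have hK : DSmooth fun a : P.Total × ℝ => EG.join σ ρ hσ hρ hσρ (Φ₀ a.1) (Φ₁ a.1) a.2 :=
    fun n p hp => EG.join_smooth hσ hρ hσρ n (fun y => ((Φ₀ (p y).1, Φ₁ (p y).1), (p y).2))
      ⟨⟨hΦ₀ n _ hp.1, hΦ₁ n _ hp.1⟩, hp.2⟩
  have e : k₀.Homotopic k₁ := hP.homotopic hK
    (fun x g s => by rw [hact₀, hact₁, EG.join_act])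
    (fun x => by rw [hk₀, EG.join_zero]) (fun x => by rw [hk₁, EG.join_one])
  exact SmoothMap.homotopic_equivalence.trans (SmoothMap.homotopic_equivalence.trans e₀ e)
    (SmoothMap.homotopic_equivalence.symm e₁)

end GSpaceOver

/-! ### A smooth step size -/

/-- The integral is the convolution of the constant 1 with `s ↦ g y (-s)`, evaluated at 0; uniform
compact support makes a parametrized convolution smooth. -/
theorem contDiff_integral_of_support {E : Type u} [NormedAddCommGroup E] [NormedSpace ℝ E]
    {g : E → ℝ → ℝ} (hg : ContDiff ℝ ∞ fun a : E × ℝ => g a.1 a.2)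
    (h : ∀ y s, s ∉ Set.Icc (0 : ℝ) 1 → g y s = 0) : ContDiff ℝ ∞ fun y => ∫ s, g y s := by
  have h1 := MeasureTheory.contDiffOn_convolution_right_with_param (μ := MeasureTheory.volume)
    (f := fun _ : ℝ => (1 : ℝ)) (n := ⊤) (ContinuousLinearMap.mul ℝ ℝ)
    (g := fun y s => g y (-s)) (s := Set.univ) (k := Set.Icc (-1) 0) isOpen_univ isCompact_Icc
    (fun y s _ hs => h y (-s) fun hc => hs ⟨by linarith [hc.2], by linarith [hc.1]⟩)
    (MeasureTheory.locallyIntegrable_const 1)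
    (hg.comp (contDiff_fst.prodMk contDiff_snd.neg)).contDiffOn
  have h2 : ContDiff ℝ ∞ fun y : E => (y, (0 : ℝ)) := contDiff_id.prodMk contDiff_const
  have h3 := (contDiffOn_univ.1 (h1.mono (fun a _ => ⟨trivial, trivial⟩ :
    Set.univ ⊆ Set.univ ×ˢ Set.univ))).comp h2
  simpa [MeasureTheory.convolution, Function.comp_def] using h3

/-- With `a = 1 + ∫ e`, the inequality `|c'| ≤ c'² / (4a) + a` integrates over an interval of length
at most `ε` to at most `1/4 + 1/8`. Bounding by energy instead of length keeps the bound smooth in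
parameters. -/
theorem abs_sub_lt_half {c e : ℝ → ℝ} (hc : ContDiff ℝ ∞ c) (he : Continuous e)
    (hi : MeasureTheory.Integrable e) (hce : ∀ s, deriv c s ^ 2 ≤ e s) {ε : ℝ}
    (hε : ε * (1 + ∫ s, e s) ≤ 1 / 8) {s s' : ℝ} (hs : |s' - s| ≤ ε) : |c s' - c s| < 1 / 2 := by
  wlog hle : s ≤ s' generalizing s s'
  · rw [abs_sub_comm]
    exact this (by rwa [abs_sub_comm]) (not_le.1 hle).le
  have hd : Continuous (deriv c) := hc.continuous_deriv (by simp)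
  have he0 : ∀ s, 0 ≤ e s := fun s => (sq_nonneg _).trans (hce s)
  set D := ∫ s, e s with hD
  have hD0 : 0 ≤ D := MeasureTheory.integral_nonneg he0
  set a := 1 + D with ha
  have ha0 : 0 < a := by linarith
  have h1 : ∫ r in s..s', deriv c r = c s' - c s :=
    intervalIntegral.integral_deriv_eq_sub (fun r _ => hc.differentiable (by simp) r)
      (hd.intervalIntegrable _ _)
  have h2 : ∀ r, |deriv c r| ≤ e r / (4 * a) + a := fun r => by
    have h3 : |deriv c r| ≤ deriv c r ^ 2 / (4 * a) + a := by
      rw [← sq_abs, div_add' _ _ _ (by positivity), le_div_iff₀ (by positivity)]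
      nlinarith [sq_nonneg (|deriv c r| - 2 * a)]
    exact h3.trans (by gcongr; exact hce r)
  have hcont : Continuous fun r => e r / (4 * a) + a := (he.div_const _).add continuous_const
  have h4 : |∫ r in s..s', deriv c r| ≤ ∫ r in s..s', (e r / (4 * a) + a) := by
    rw [← Real.norm_eq_abs]
    exact intervalIntegral.norm_integral_le_of_norm_le hle
      (Filter.Eventually.of_forall fun r _ => h2 r) (hcont.intervalIntegrable _ _)
  have h5 : ∫ r in s..s', (e r / (4 * a) + a) = (∫ r in s..s', e r) / (4 * a) + (s' - s) * a := by
    rw [intervalIntegral.integral_add ((he.div_const _).intervalIntegrable _ _)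
      (continuous_const.intervalIntegrable _ _), intervalIntegral.integral_div,
      intervalIntegral.integral_const, smul_eq_mul]
  have h6 : ∫ r in s..s', e r ≤ D := by
    rw [intervalIntegral.integral_of_le hle]
    exact MeasureTheory.setIntegral_le_integral hi (Filter.Eventually.of_forall he0)
  have h7 : (∫ r in s..s', e r) / (4 * a) ≤ 1 / 4 := by
    rw [div_le_iff₀ (by positivity)]
    linarith
  have h8 : (s' - s) * a ≤ 1 / 8 :=
    (mul_le_mul_of_nonneg_right ((le_abs_self _).trans hs) ha0.le).trans hε
  rw [← h1]
  linarith

section StepSize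

variable {B : Type v} [DiffeologicalSpace B]

/-- Plots are defined on `EuclideanSpace`, so the parameter space times `ℝ` is first identified with
one. -/
theorem contDiff_along {φ : B × ℝ → ℝ} (hφ : DSmooth φ) {n : ℕ}
    {p : EuclideanSpace ℝ (Fin n) → B} (hp : IsPlot p) :
    ContDiff ℝ ∞ fun a : EuclideanSpace ℝ (Fin n) × ℝ => φ (p a.1, a.2) := by
  let e := toEuclidean (E := EuclideanSpace ℝ (Fin n) × ℝ)
  have h := IsPlot.contDiff (hφ _ (fun z => (p (e.symm z).1, (e.symm z).2))
    ⟨isPlot_reparam hp e.symm.contDiff.fst, e.symm.contDiff.snd.isPlot⟩)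
  simpa [Function.comp_def] using h.comp e.contDiff

theorem eventually_eq_zero_along {T : B × ℝ → Simplex} (hT : DSmooth T) {n : ℕ}
    {p : EuclideanSpace ℝ (Fin n) → B} (hp : IsPlot p) (z : EuclideanSpace ℝ (Fin n) × ℝ) :
    ∃ N : ℕ, ∀ᶠ a in 𝓝 z, ∀ i, N ≤ i → (T (p a.1, a.2)).1 i = 0 := by
  let e := toEuclidean (E := EuclideanSpace ℝ (Fin n) × ℝ)
  have h : IsPlot fun x => T (p (e.symm x).1, (e.symm x).2) :=
    hT _ (fun z => (p (e.symm z).1, (e.symm z).2))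
      ⟨isPlot_reparam hp e.symm.contDiff.fst, e.symm.contDiff.snd.isPlot⟩
  obtain ⟨N, hN⟩ := IsPlot.eventually_eq_zero h (e z)
  refine ⟨N, (e.continuous.continuousAt.eventually hN).mono fun a ha i hi => ?_⟩
  simpa using ha i hi

/-- The `i`-th coordinate relative to the sum of the squares of all coordinates. -/
def ratio (T : B × ℝ → Simplex) (i : ℕ) (a : B × ℝ) : ℝ := (T a).1 i / (T a).sq

/-- The density of the energy of the curves `s ↦ ratio T i (b, s)`. -/
def energyDensity (T : B × ℝ → Simplex) (b : B) (s : ℝ) : ℝ :=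
  ∑ᶠ i, deriv (fun s => ratio T i (b, s)) s ^ 2

variable {T : B × ℝ → Simplex} (hT : DSmooth T)
include hT

theorem ratio_smooth (i : ℕ) : DSmooth (ratio T i) := fun n p hp =>
  ((IsPlot.contDiff ((hT n p hp).1 i)).div (IsPlot.contDiff (Simplex.sq_smooth n _ (hT n p hp)))
    fun y => (T (p y)).sq_pos.ne').isPlot

theorem contDiff_ratio (b : B) (i : ℕ) : ContDiff ℝ ∞ fun s => ratio T i (b, s) :=
  (contDiff_along (ratio_smooth hT i) (n := 0) (p := fun _ => b) isPlot_const).comp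
    (contDiff_const.prodMk contDiff_id : ContDiff ℝ ∞ fun s : ℝ => ((0 : EuclideanSpace ℝ (Fin 0)), s))

/-- Writing the time derivative through the total derivative shows that it is jointly smooth in the
parameter and the time. -/
theorem deriv_ratio_eq {n : ℕ} {p : EuclideanSpace ℝ (Fin n) → B} (hp : IsPlot p) (i : ℕ)
    (a : EuclideanSpace ℝ (Fin n) × ℝ) :
    deriv (fun s => ratio T i (p a.1, s)) a.2 =
      fderiv ℝ (fun a : EuclideanSpace ℝ (Fin n) × ℝ => ratio T i (p a.1, a.2)) a (0, 1) := by
  have h1 := ((contDiff_along (ratio_smooth hT i) hp).differentiable (by simp) a).hasFDerivAt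
  have h2 : HasDerivAt (fun s : ℝ => (a.1, s)) ((0 : EuclideanSpace ℝ (Fin n)), (1 : ℝ)) a.2 :=
    (hasDerivAt_const a.2 a.1).prodMk (hasDerivAt_id a.2)
  exact (HasFDerivAt.comp_hasDerivAt (f := fun s : ℝ => (a.1, s)) a.2 h1 h2).deriv

theorem deriv_ratio_eventually_eq_zero {n : ℕ} {p : EuclideanSpace ℝ (Fin n) → B} (hp : IsPlot p)
    (z : EuclideanSpace ℝ (Fin n) × ℝ) :
    ∃ N : ℕ, ∀ᶠ a in 𝓝 z, ∀ i, N ≤ i → deriv (fun s => ratio T i (p a.1, s)) a.2 = 0 := by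
  obtain ⟨N, hN⟩ := eventually_eq_zero_along hT hp z
  refine ⟨N, (eventually_eventually_nhds.2 hN).mono fun a ha i hi => ?_⟩
  have h : (fun a : EuclideanSpace ℝ (Fin n) × ℝ => ratio T i (p a.1, a.2)) =ᶠ[𝓝 a] fun _ => 0 :=
    ha.mono fun a' ha' => by simp only [ratio, ha' i hi, zero_div]
  rw [deriv_ratio_eq hT hp, h.fderiv_eq]
  simp

theorem contDiff_energyDensity {n : ℕ} {p : EuclideanSpace ℝ (Fin n) → B} (hp : IsPlot p) :
    ContDiff ℝ ∞ fun a : EuclideanSpace ℝ (Fin n) × ℝ => energyDensity T (p a.1) a.2 := by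
  refine contDiff_finsum_nat (fun i => ContDiff.pow ?_ 2) fun z => ?_
  · simp only [deriv_ratio_eq hT hp]
    exact ((contDiff_along (ratio_smooth hT i) hp).fderiv_right (m := ∞) (by simp)).clm_apply
      contDiff_const
  · obtain ⟨N, hN⟩ := deriv_ratio_eventually_eq_zero hT hp z
    exact ⟨N, hN.mono fun a ha i hi => by rw [ha i hi, zero_pow two_ne_zero]⟩

theorem deriv_sq_le_energyDensity (b : B) (s : ℝ) (i : ℕ) :
    deriv (fun s => ratio T i (b, s)) s ^ 2 ≤ energyDensity T b s := by
  obtain ⟨N, hN⟩ := deriv_ratio_eventually_eq_zero hT (n := 0) (p := fun _ => b) isPlot_const (0, s)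
  refine single_le_finsum (f := fun i => deriv (fun s => ratio T i (b, s)) s ^ 2) i ((Finset.range N).finite_toSet.subset fun j hj => ?_)
    fun j => sq_nonneg _
  by_contra hc
  refine hj ?_
  simp only [hN.self_of_nhds j (by simpa using hc), zero_pow two_ne_zero]

/-- A step size for a path of points of the simplex, constant outside `[0, 1]`, such that the large
coordinates stay different from zero during a step. -/
theorem exists_step (h0 : ∀ b s, s ≤ 0 → T (b, s) = T (b, 0))
    (h1 : ∀ b s, 1 ≤ s → T (b, s) = T (b, 1)) :
    ∃ ε : B → ℝ, DSmooth ε ∧ (∀ b, 0 < ε b) ∧ ∀ b i s s', |s' - s| ≤ ε b →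
      (T (b, s)).sq / 2 ≤ (T (b, s)).1 i → (T (b, s')).1 i ≠ 0 := by
  have hd : ∀ b s, s ∉ Set.Icc (0 : ℝ) 1 → energyDensity T b s = 0 := fun b s hs => by
    have key : ∀ i, deriv (fun s => ratio T i (b, s)) s = 0 := fun i => by
      rw [Set.mem_Icc, not_and_or, not_le, not_le] at hs
      rcases hs with hs | hs
      · have : (fun s => ratio T i (b, s)) =ᶠ[𝓝 s] fun _ => ratio T i (b, 0) :=
          (eventually_lt_nhds hs).mono fun r hr => by simp only [ratio, h0 b r hr.le]
        rw [this.deriv_eq, deriv_const]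
      · have : (fun s => ratio T i (b, s)) =ᶠ[𝓝 s] fun _ => ratio T i (b, 1) :=
          (eventually_gt_nhds hs).mono fun r hr => by simp only [ratio, h1 b r hr.le]
        rw [this.deriv_eq, deriv_const]
    simp [energyDensity, key]
  have hpos : ∀ b, 0 < 8 * (1 + ∫ s, energyDensity T b s) := fun b => by
    have : 0 ≤ ∫ s, energyDensity T b s := MeasureTheory.integral_nonneg fun s =>
      (sq_nonneg _).trans (deriv_sq_le_energyDensity hT b s 0)
    linarith
  have hc : ∀ b, Continuous (energyDensity T b) := fun b =>
    ((contDiff_energyDensity hT (n := 0) (p := fun _ => b) isPlot_const).continuous).comp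
      (continuous_const.prodMk continuous_id : Continuous fun s : ℝ =>
        ((0 : EuclideanSpace ℝ (Fin 0)), s))
  -- The largest step allowed by `abs_sub_lt_half`; the summand 1 avoids division by zero for
  -- constant paths.
  refine ⟨fun b => 1 / (8 * (1 + ∫ s, energyDensity T b s)), fun n p hp => ?_,
    fun b => one_div_pos.2 (hpos b), fun b i s s' hs hi => ?_⟩
  · exact (contDiff_const.div (contDiff_const.mul (contDiff_const.add
      (contDiff_integral_of_support (contDiff_energyDensity hT hp) fun y s => hd (p y) s)))
      fun y => (hpos (p y)).ne').isPlot
  · have h2 := abs_sub_lt_half (contDiff_ratio hT b i) (hc b)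
      ((hc b).integrable_of_hasCompactSupport (HasCompactSupport.intro isCompact_Icc (hd b)))
      (fun r => deriv_sq_le_energyDensity hT b r i) (ε := 1 / (8 * (1 + ∫ s, energyDensity T b s)))
      (by
        have := hpos b
        rw [one_div, mul_inv, mul_assoc, inv_mul_cancel₀ (by linarith)]
        norm_num) hs
    -- A large coordinate has ratio at least 1/2, and a step changes the ratio by less than 1/2, so
    -- it cannot reach 0.
    have h3 : 1 / 2 ≤ ratio T i (b, s) := by
      rw [ratio, le_div_iff₀ (Simplex.sq_pos _)]
      linarith
    intro h4
    rw [show ratio T i (b, s') = 0 by rw [ratio, h4, zero_div], zero_sub, abs_neg,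
      abs_of_pos (by linarith)] at h2
    linarith

end StepSize

/-! ### Transport along homotopies -/

section Transport

variable {G : Type u} [Group G] [DiffeologicalSpace G] {B : Type v} [DiffeologicalSpace B]

/-- A smooth equivariant map from the pullback of the universal bundle along `f₀` to the one along
`f₁`, which is the identity over `A`. -/
structure IsTransport (f₀ f₁ : B → BG G) (H : B → EG G → EG G) (A : Set B) : Prop where
  proj : ∀ b x, Quotient.mk (bSetoid G) x = f₀ b → Quotient.mk (bSetoid G) (H b x) = f₁ b
  act : ∀ b x g, Quotient.mk (bSetoid G) x = f₀ b → H b (EG.act x g) = EG.act (H b x) g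
  smooth : ∀ (n : ℕ) (p : EuclideanSpace ℝ (Fin n) → B) (q : EuclideanSpace ℝ (Fin n) → EG G),
    IsPlot p → IsPlot q → (∀ y, Quotient.mk (bSetoid G) (q y) = f₀ (p y)) →
    IsPlot fun y => H (p y) (q y)
  eq_self : ∀ b ∈ A, ∀ x, Quotient.mk (bSetoid G) x = f₀ b → H b x = x

theorem IsTransport.iso [DiffeologicalGroup G] {f₀ f₁ : B → BG G} {H : B → EG G → EG G}
    {A : Set B} (h : IsTransport f₀ f₁ H A) (hf₀ : DSmooth f₀) (hf₁ : DSmooth f₁) :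
    ((universalBundle G).pullback f₀ hf₀).Iso ((universalBundle G).pullback f₁ hf₁) :=
  GSpaceOver.Iso.of_isTorsor (P := (universalBundle G).pullback f₀ hf₀)
    (Q := (universalBundle G).pullback f₁ hf₁) (universalBundle_isTorsor.pullback hf₀)
    (universalBundle_isTorsor.pullback hf₁)
    (fun x => ⟨(x.1.1, H x.1.1 x.1.2), (h.proj _ _ x.2.symm).symm⟩)
    (fun n p hp => ⟨hp.1, h.smooth n (fun y => (p y).1.1) (fun y => (p y).1.2) hp.1 hp.2
      fun y => (p y).2.symm⟩) (fun _ => rfl)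
    fun x g => Subtype.ext (Prod.ext rfl (h.act _ _ g x.2.symm))

theorem IsTransport.refl (f : B → BG G) (A : Set B) : IsTransport f f (fun _ x => x) A :=
  ⟨fun _ _ h => h, fun _ _ _ _ => rfl, fun _ _ _ _ hq _ => hq, fun _ _ _ _ => rfl⟩

theorem IsTransport.trans {f₀ f₁ f₂ : B → BG G} {H K : B → EG G → EG G} {A : Set B}
    (h : IsTransport f₀ f₁ H A) (k : IsTransport f₁ f₂ K A) :
    IsTransport f₀ f₂ (fun b x => K b (H b x)) A where
  proj b x hx := k.proj b _ (h.proj b x hx)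
  act b x g hx := by rw [h.act b x g hx, k.act b _ g (h.proj b x hx)]
  smooth n p q hp hq hpq := k.smooth n p _ hp (h.smooth n p q hp hq hpq)
    fun y => h.proj _ _ (hpq y)
  eq_self b hb x hx := by
    have := h.eq_self b hb x hx
    rw [this]
    exact k.eq_self b hb x (by rw [← h.proj b x hx, this])

theorem IsTransport.mono {f₀ f₁ : B → BG G} {H : B → EG G → EG G} {A A' : Set B}
    (h : IsTransport f₀ f₁ H A) (hA : A' ⊆ A) : IsTransport f₀ f₁ H A' :=
  ⟨h.proj, h.act, h.smooth, fun b hb => h.eq_self b (hA hb)⟩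

/-- A sequence of transports which is locally eventually constant can be composed. -/
theorem exists_isTransport_of_sequence {f : ℕ → B → BG G} {f' : B → BG G}
    {H : ℕ → B → EG G → EG G} {A : ℕ → Set B}
    (h : ∀ k, IsTransport (f k) (f (k + 1)) (H k) (A k))
    (hloc : ∀ (n : ℕ) (p : EuclideanSpace ℝ (Fin n) → B), IsPlot p → ∀ z, ∃ N : ℕ,
      ∀ᶠ y in 𝓝 z, ∀ k, N ≤ k → p y ∈ A k ∧ f k (p y) = f' (p y)) :
    ∃ K, IsTransport (f 0) f' K (⋂ k, A k) := by
  let C : ℕ → B → EG G → EG G := fun k => Nat.rec (fun _ x => x) (fun k c b x => H k b (c b x)) k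
  have hC : ∀ k, IsTransport (f 0) (f k) (C k) (⋂ k, A k) := fun k => by
    induction k with
    | zero => exact IsTransport.refl _ _
    | succ k ih => exact ih.trans ((h k).mono (Set.iInter_subset A k))
  have hN : ∀ b, ∃ N : ℕ, ∀ k, N ≤ k → b ∈ A k ∧ f k b = f' b := fun b => by
    obtain ⟨N, hN⟩ := hloc 0 (fun _ => b) isPlot_const 0
    exact ⟨N, hN.self_of_nhds⟩
  choose N hN using hN
  have hadd : ∀ b M, (∀ k, M ≤ k → b ∈ A k) → ∀ x, Quotient.mk (bSetoid G) x = f 0 b →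
      ∀ k, M ≤ k → C k b x = C M b x := fun b M hM x hx k hk => by
    induction k, hk using Nat.le_induction with
    | base => rfl
    | succ k hk ih => exact ((h k).eq_self b (hM k hk) _ ((hC k).proj b x hx)).trans ih
  have key : ∀ b M, (∀ k, M ≤ k → b ∈ A k) → ∀ x, Quotient.mk (bSetoid G) x = f 0 b →
      C (N b) b x = C M b x := fun b M hM x hx =>
    (hadd b (N b) (fun k hk => (hN b k hk).1) x hx _ (le_max_left _ M)).symm.trans
      (hadd b M hM x hx _ (le_max_right _ _))
  -- The number of composed transports depends on `b` without any regularity; along a plot, `key`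
  -- replaces it near each parameter by a common `M`.
  refine ⟨fun b x => C (N b) b x, fun b x hx => ?_, fun b x g hx => (hC _).act b x g hx,
    fun n p q hp hq hpq => isPlot_of_locally fun z => ?_, fun b hb x hx => (hC _).eq_self b hb x hx⟩
  · rw [(hC _).proj b x hx, (hN b _ le_rfl).2]
  · obtain ⟨M, hM⟩ := hloc n p hp z
    exact ⟨_, (hC M).smooth n p q hp hq hpq, hM.mono fun y hy =>
      key _ M (fun k hk => (hy k hk).1) _ (hpq y)⟩

end Transport

/-! ### Sections of the universal bundle over its charts -/

namespace EG

section

variable {G : Type u} [Group G]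

/-- The point of the fibre over `b` whose `i`-th group coordinate is `1`. -/
def sec (i : ℕ) (b : BG G) : EG G := act b.out (chart i b.out)⁻¹

theorem mk_act (x : EG G) (g : G) :
    Quotient.mk (bSetoid G) (act x g) = Quotient.mk (bSetoid G) x :=
  (Quotient.sound (s := bSetoid G) ⟨g, rfl⟩).symm

theorem mk_sec (i : ℕ) (b : BG G) : Quotient.mk (bSetoid G) (sec i b) = b := by
  rw [sec, mk_act, Quotient.out_eq]

/-- The point `x · g_i(x)⁻¹` is unchanged when `x` moves in its orbit. Thus the arbitrary
representative in `sec` does not matter and a local lift may be used instead, which makes `sec`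
smooth on the chart. -/
theorem sec_mk {i : ℕ} {x : EG G} (h : (coord x).1 i ≠ 0) :
    sec i (Quotient.mk (bSetoid G) x) = act x (chart i x)⁻¹ := by
  obtain ⟨g, hg⟩ := Quotient.exact (Quotient.out_eq (Quotient.mk (bSetoid G) x))
  rw [sec]
  generalize Quotient.out (Quotient.mk (bSetoid G) x) = y at hg
  subst hg
  rw [coord_act] at h
  rw [chart_act h, ← act_mul, mul_inv_rev, mul_inv_cancel_left]

end

variable {G : Type u} [Group G] [DiffeologicalSpace G] [DiffeologicalGroup G]

theorem act_plot {n : ℕ} {p : EuclideanSpace ℝ (Fin n) → EG G}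
    {γ : EuclideanSpace ℝ (Fin n) → G} (hp : IsPlot p) (hγ : IsPlot γ) :
    IsPlot fun y => act (p y) (γ y) :=
  (universalBundle G).act_plot hp hγ

theorem sec_plot {i n : ℕ} {r : EuclideanSpace ℝ (Fin n) → BG G} (hr : IsPlot r)
    (h : ∀ y, (BG.coord (r y)).1 i ≠ 0) : IsPlot fun y => sec i (r y) :=
  isPlot_of_locally fun z => by
    obtain ⟨q, hq, hqz⟩ := hr z
    obtain ⟨k, hk, hk', hkz⟩ := exists_smooth_into_nhds hqz
    have hk2 : ∀ y, r (k y) = Quotient.mk (bSetoid G) (q (k y)) := hk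
    have h' : ∀ y, (coord (q (k y))).1 i ≠ 0 := fun y => by
      have := h (k y)
      rwa [hk2 y] at this
    have hqk : IsPlot fun y => q (k y) := isPlot_reparam hq hk'
    refine ⟨_, act_plot hqk (IsPlot.inv (chart_plot hqk h')), hkz.mono fun y hy => ?_⟩
    rw [← sec_mk (h' y), ← hk2 y, hy]

end EG

/-! ### Homotopic maps have isomorphic pullbacks -/

section Homotopy

variable {G : Type u} [Group G] [DiffeologicalSpace G] [DiffeologicalGroup G]
  {B : Type v} [DiffeologicalSpace B]

/-- Transport through the `i`-th chart of the universal bundle. -/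
theorem exists_isTransport_chart {f₀ f₁ : B → BG G} (hf₀ : DSmooth f₀) (hf₁ : DSmooth f₁) (i : ℕ)
    (h : ∀ (n : ℕ) (p : EuclideanSpace ℝ (Fin n) → B), IsPlot p → ∀ z,
      (∀ᶠ y in 𝓝 z, f₀ (p y) = f₁ (p y)) ∨
        ((BG.coord (f₀ (p z))).1 i ≠ 0 ∧ (BG.coord (f₁ (p z))).1 i ≠ 0)) :
    ∃ H, IsTransport f₀ f₁ H {b | f₀ b = f₁ b} := by
  classical
  -- A point is sent to the point over `f₁ b` with the same `i`-th group coordinate. Where `f₀ b =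
  -- f₁ b` and this coordinate is defined, the formula returns the point itself, so the two clauses
  -- agree on overlaps.
  let H : B → EG G → EG G := fun b x =>
    if f₀ b = f₁ b then x else EG.act (EG.sec i (f₁ b)) (EG.chart i x)
  have hH : ∀ {b x}, Quotient.mk (bSetoid G) x = f₀ b → (BG.coord (f₀ b)).1 i ≠ 0 →
      H b x = EG.act (EG.sec i (f₁ b)) (EG.chart i x) := fun {b x} hx hi => by
    by_cases hb : f₀ b = f₁ b
    · have hi' : (EG.coord x).1 i ≠ 0 := by rwa [← hx] at hi
      simp only [H, if_pos hb]
      rw [← hb, ← hx, EG.sec_mk hi', ← EG.act_mul, inv_mul_cancel, EG.act_one]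
    · simp only [H, if_neg hb]
  have hne : ∀ b, f₀ b ≠ f₁ b → (BG.coord (f₀ b)).1 i ≠ 0 := fun b hb => by
    rcases h 0 (fun _ => b) isPlot_const 0 with h | h
    · exact absurd h.self_of_nhds hb
    · exact h.1
  refine ⟨H, fun b x hx => ?_, fun b x g hx => ?_, fun n p q hp hq hpq => ?_,
    fun b hb x _ => if_pos hb⟩
  · by_cases hb : f₀ b = f₁ b
    · simp only [H, if_pos hb, hx, hb]
    · simp only [H, if_neg hb, EG.mk_act, EG.mk_sec]
  · by_cases hb : f₀ b = f₁ b
    · simp only [H, if_pos hb]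
    · have hi := hne b hb
      rw [← hx] at hi
      simp only [H, if_neg hb]
      rw [EG.chart_act hi, EG.act_mul]
  · refine isPlot_of_nhds fun z => ?_
    rcases h n p hp z with h | ⟨h0, h1⟩
    · refine ⟨_, h, fun m k hk hk' => ?_⟩
      have : (fun y => H (p y) (q y)) ∘ k = q ∘ k := funext fun y => if_pos (hk y)
      rw [this]
      exact isPlot_reparam hq hk'
    · have hc : ∀ {f : B → BG G}, DSmooth f → Continuous fun y => (BG.coord (f (p y))).1 i :=
        fun hf => (IsPlot.contDiff ((BG.coord_smooth n _ (hf n p hp)).1 i)).continuous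
      refine ⟨_, Filter.inter_mem ((isOpen_ne_fun (hc hf₀) continuous_const).mem_nhds h0)
        ((isOpen_ne_fun (hc hf₁) continuous_const).mem_nhds h1), fun m k hk hk' => ?_⟩
      have hk0 : ∀ y, (BG.coord (f₀ (p (k y)))).1 i ≠ 0 := fun y => (hk y).1
      have hk1 : ∀ y, (BG.coord (f₁ (p (k y)))).1 i ≠ 0 := fun y => (hk y).2
      have : (fun y => H (p y) (q y)) ∘ k = fun y =>
          EG.act (EG.sec i (f₁ (p (k y)))) (EG.chart i (q (k y))) :=
        funext fun y => hH (hpq (k y)) (hk0 y)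
      rw [this]
      refine EG.act_plot (EG.sec_plot (hf₁ m _ (isPlot_reparam hp hk')) hk1)
        (EG.chart_plot (isPlot_reparam hq hk') fun y => ?_)
      have := hk0 y
      rwa [← hpq (k y)] at this

/-- The transport over one step of a path in the classifying space, in which the large coordinates
of the initial point do not vanish. -/
theorem exists_isTransport_step {F : B × ℝ → BG G} (hF : DSmooth F) {ε τ : B → ℝ}
    (hε : DSmooth ε) (hτ : DSmooth τ) (hpos : ∀ b, 0 < ε b)
    (h : ∀ b i s, τ b ≤ s → s ≤ τ b + ε b →
      (BG.coord (F (b, τ b))).sq / 2 ≤ (BG.coord (F (b, τ b))).1 i →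
      (BG.coord (F (b, s))).1 i ≠ 0) :
    ∃ H, IsTransport (fun b => F (b, τ b)) (fun b => F (b, τ b + ε b)) H
      {b | ∀ s, τ b ≤ s → F (b, s) = F (b, τ b)} := by
  let T : B → Simplex := fun b => BG.coord (F (b, τ b))
  have hT : DSmooth T := fun n p hp => BG.coord_smooth n _ (hF n (fun y => (p y, τ (p y)))
    ⟨hp, hτ n p hp⟩)
  let S : B → Simplex := fun b => (T b).shrink
  have hS : DSmooth S := Simplex.shrink_smooth.comp hT
  -- The shrunk coordinates sum to 1, so these times run from `τ` to `τ + ε` and locally arrive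
  -- after finitely many portions.
  let u : ℕ → B → ℝ := fun n b => τ b + (∑ i ∈ Finset.range n, (S b).1 i) * ε b
  have hu : ∀ n, DSmooth (u n) := fun n m p hp =>
    ((IsPlot.contDiff (hτ m p hp)).add ((ContDiff.sum fun i _ =>
      IsPlot.contDiff ((hS m p hp).1 i)).mul (IsPlot.contDiff (hε m p hp)))).isPlot
  have hu0 : ∀ n b, τ b ≤ u n b := fun n b => le_add_of_nonneg_right
    (mul_nonneg (Finset.sum_nonneg fun i _ => (S b).nonneg i) (hpos b).le)
  have hu1 : ∀ n b, u n b ≤ τ b + ε b := fun n b => by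
    have := mul_le_mul_of_nonneg_right ((S b).sum_le_one (Finset.range n)) (hpos b).le
    rw [one_mul] at this
    simp only [u]
    linarith
  have hf : ∀ n, DSmooth fun b => F (b, u n b) := fun n m p hp =>
    hF m (fun y => (p y, u n (p y))) ⟨hp, hu n m p hp⟩
  have hmove : ∀ n, ∃ H, IsTransport (fun b => F (b, u n b)) (fun b => F (b, u (n + 1) b)) H
      {b | F (b, u n b) = F (b, u (n + 1) b)} := fun n => by
    refine exists_isTransport_chart (hf n) (hf (n + 1)) n fun m p hp z => ?_
    -- Below the threshold the `n`-th portion has length zero nearby and nothing moves; otherwise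
    -- the `n`-th coordinate is nonzero during the whole step, so its chart is available.
    rcases lt_or_ge ((T (p z)).1 n) ((T (p z)).sq / 2) with hlt | hge
    · have hc : Continuous fun y => (T (p y)).1 n := (IsPlot.contDiff ((hT m p hp).1 n)).continuous
      have hc' : Continuous fun y => (T (p y)).sq / 2 :=
        (IsPlot.contDiff (Simplex.sq_smooth m _ (hT m p hp))).continuous.div_const 2
      refine Or.inl ?_
      filter_upwards [hc.continuousAt.eventually_lt hc'.continuousAt hlt] with y hy
      simp only [u]
      rw [Finset.sum_range_succ, show (S (p y)).1 n = 0 from Simplex.shrink_eq_zero hy.le, add_zero]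
    · exact Or.inr ⟨h _ n _ (hu0 n _) (hu1 n _) hge, h _ n _ (hu0 _ _) (hu1 _ _) hge⟩
  choose H hH using hmove
  have hu00 : ∀ b, u 0 b = τ b := fun b => by simp [u]
  obtain ⟨K, hK⟩ := exists_isTransport_of_sequence (f' := fun b => F (b, τ b + ε b)) hH
    fun m p hp z => by
      obtain ⟨N, hN⟩ := IsPlot.eventually_eq_zero (hS m p hp) z
      refine ⟨N, hN.mono fun y hy k hk => ?_⟩
      have huk : ∀ k, N ≤ k → u k (p y) = τ (p y) + ε (p y) := fun k hk => by
        simp only [u]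
        rw [← finsum_eq_sum_range (f := fun i => (S (p y)).1 i) fun i hi => hy i (hk.trans hi),
          Simplex.finsum_eq_one, one_mul]
      exact ⟨by simp only [Set.mem_ofPred_eq, huk k hk, huk (k + 1) (by lia)], by rw [huk k hk]⟩
  simp only [hu00] at hK
  refine ⟨K, hK.mono fun b hb => Set.mem_iInter.2 fun n => ?_⟩
  exact (hb _ (hu0 n b)).trans (hb _ (hu0 (n + 1) b)).symm

/-- Pullbacks of the universal bundle along homotopic maps are isomorphic. -/
theorem SmoothMap.Homotopic.iso_pullback {f₀ f₁ : SmoothMap B (BG G)} (h : f₀.Homotopic f₁) :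
    ((universalBundle G).pullback f₀.toFun f₀.smooth).Iso
      ((universalBundle G).pullback f₁.toFun f₁.smooth) := by
  obtain ⟨F', hF', h0, h1⟩ := h
  -- The reparametrization makes the homotopy stationary outside `[0, 1]`, which gives the energy
  -- compact support and makes late steps trivial.
  let F : B × ℝ → BG G := fun a => F' (a.1, Real.smoothTransition a.2)
  have hF : DSmooth F := fun n p hp => hF' n (fun y => ((p y).1, Real.smoothTransition (p y).2))
    ⟨hp.1, (Real.smoothTransition.contDiff.comp (IsPlot.contDiff hp.2)).isPlot⟩
  have hF0 : ∀ b s, s ≤ 0 → F (b, s) = f₀.toFun b := fun b s hs => by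
    simp only [F, Real.smoothTransition.zero_of_nonpos hs, h0]
  have hF1 : ∀ b s, 1 ≤ s → F (b, s) = f₁.toFun b := fun b s hs => by
    simp only [F, Real.smoothTransition.one_of_one_le hs, h1]
  obtain ⟨ε, hε, hpos, hstep⟩ := exists_step (T := fun a => BG.coord (F a))
    (BG.coord_smooth.comp hF)
    (fun b s hs => by simp only [hF0 b s hs, hF0 b 0 le_rfl])
    (fun b s hs => by simp only [hF1 b s hs, hF1 b 1 le_rfl])
  -- The `k`-th step runs from `k ε(b)` to `(k + 1) ε(b)`; it is the identity once `k ε(b) ≥ 1`.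
  have hmove : ∀ k : ℕ, ∃ H, IsTransport (fun b => F (b, k * ε b))
      (fun b => F (b, (k + 1 : ℕ) * ε b)) H {b | 1 ≤ k * ε b} := fun k => by
    have hτ : DSmooth fun b => k * ε b := fun n p hp =>
      (contDiff_const.mul (IsPlot.contDiff (hε n p hp))).isPlot
    obtain ⟨H, hH⟩ := exists_isTransport_step hF hε hτ hpos fun b i s hs hs' hi =>
      hstep b i _ s (by rw [abs_of_nonneg (by linarith)]; linarith) hi
    refine ⟨H, ?_⟩
    have he : ∀ b, ((k + 1 : ℕ) : ℝ) * ε b = k * ε b + ε b := fun b => by push_cast; ring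
    simp only [he]
    refine hH.mono fun b hb s hs => ?_
    have hb' : 1 ≤ k * ε b := hb
    rw [hF1 b _ hb', hF1 b s (hb'.trans hs)]
  choose H hH using hmove
  obtain ⟨K, hK⟩ := exists_isTransport_of_sequence (f' := f₁.toFun) hH fun n p hp z => by
    -- Near `z` the step size stays above half its value at `z`, so `N` steps pass time 1 throughout
    -- a neighbourhood.
    obtain ⟨N, hN⟩ := exists_nat_gt (1 / (ε (p z) / 2))
    have hz := hpos (p z)
    rw [div_lt_iff₀ (by linarith)] at hN
    refine ⟨N, ?_⟩
    filter_upwards [continuousAt_const.eventually_lt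
      (IsPlot.continuous_real hε hp).continuousAt (half_lt_self hz)] with y hy k hk
    have hk' : (N : ℝ) ≤ k := Nat.cast_le.2 hk
    have h2 : 1 ≤ k * ε (p y) :=
      hN.le.trans (mul_le_mul hk' hy.le (by linarith) (Nat.cast_nonneg k))
    exact ⟨h2, hF1 _ _ h2⟩
  refine IsTransport.iso (f₀ := f₀.toFun) (H := K) (A := ⋂ k : ℕ, {b | 1 ≤ k * ε b}) ?_ _ _
  convert! hK using 1
  exact funext fun b => (hF0 b _ (by simp)).symm

end Homotopy

/-! ### The classification -/

section

variable {G B : Type u} [Group G] [DiffeologicalSpace G] [DiffeologicalGroup G]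
  [DiffeologicalSpace B]

variable (G B) in
/-- The classification map `[f] ↦ [f^*(EG → BG)]`. -/
def classify : HomotopyClass B (BG G) → PrinD G B :=
  Quotient.lift (fun f => PrinD.mk _
    (GSpaceOver.isDNumerablePrincipal_pullback_universalBundle f.smooth)) fun _ _ h =>
      Quotient.sound (s := prinSetoid G B) (SmoothMap.Homotopic.iso_pullback h)

variable (G B) in
theorem isPullbackMap_classify : IsPullbackMap (classify G B) := fun f =>
  ⟨GSpaceOver.isDNumerablePrincipal_pullback_universalBundle f.smooth, rfl⟩

-- An isomorphism between the two pullbacks equips the first with a second equivariant map to `EG`,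
-- covering `f₁`, besides its own covering `f₀`; any two such maps have homotopic classifying maps.
variable (G B) in
theorem classify_injective : Function.Injective (classify G B) := by
  intro c d
  refine Quotient.inductionOn₂ c d fun f₀ f₁ h => ?_
  obtain ⟨e, h1, -, h3, h4⟩ := Quotient.exact (s := prinSetoid G B) h
  refine Quotient.sound (s := SmoothMap.homotopySetoid B (BG G)) ?_
  refine GSpaceOver.IsTorsor.homotopic_of_classifying
    (P := (universalBundle G).pullback f₀.toFun f₀.smooth)
    (universalBundle_isTorsor.pullback f₀.smooth) (Φ₀ := fun x => x.1.2)
    (Φ₁ := fun x => (e x).1.2) (fun n p hp => hp.2) (fun n p hp => (h1 n p hp).2)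
    (fun x g => rfl) (fun x g => congrArg (fun z => z.1.2) (h4 x g)) (fun x => x.2) fun x => ?_
  exact (congrArg f₁.toFun (h3 x)).symm.trans (e x).2

variable (G B) in
theorem classify_surjective : Function.Surjective (classify G B) := by
  intro c
  refine Quotient.inductionOn c fun ⟨P, hP⟩ => ?_
  obtain ⟨τ, ψ, h⟩ := hP.exists_isNumeration
  obtain ⟨Φ, hΦ, hact⟩ := h.exists_classifying
  obtain ⟨f, hf⟩ := hP.isTorsor.exists_classifying hΦ hact
  exact ⟨HomotopyClass.mk f, Quotient.sound (s := prinSetoid G B)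
    (hP.isTorsor.iso_pullback hΦ hact hf).symm⟩

end

/-! ### Naturality in the group -/

section

variable {G G' : Type u} [Group G] [Group G']

theorem EG.map_act (h : G →* G') (x : EG G) (g : G) :
    EG.map h (EG.act x g) = EG.act (EG.map h x) (h g) := by
  induction x using Quotient.inductionOn with
  | h a => exact EG.mk_eq_mk fun i _ => map_mul h _ _

theorem EG.act_map_act (h : G →* G') (x : EG G) (g : G) (k : G') :
    EG.act (EG.map h (EG.act x g)) ((h g)⁻¹ * k) = EG.act (EG.map h x) k := by
  rw [EG.map_act, ← EG.act_mul, mul_inv_cancel_left]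

variable [DiffeologicalSpace G] [DiffeologicalSpace G']

theorem EG.map_smooth {h : G →* G'} (hh : DSmooth h) : DSmooth (EG.map h) :=
  dSmooth_of_mk (dSmooth_mk.comp
    (dSmooth_prodMk dSmooth_fst fun n _ hp i => hh n _ (hp.2 i)))

variable [DiffeologicalGroup G] [DiffeologicalGroup G'] {B : Type u} [DiffeologicalSpace B]

/-- Extension of the structure group corresponds to composition with `BG → BG'`. -/
theorem iso_extend_pullback (h : G →* G') (hh : DSmooth h) (f : SmoothMap B (BG G)) :
    (((universalBundle G).pullback f.toFun f.smooth).extend h).Iso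
      ((universalBundle G').pullback ((BG.map h hh).comp f).toFun
        ((BG.map h hh).comp f).smooth) := by
  let P := (universalBundle G).pullback f.toFun f.smooth
  have hP : P.IsDNumerablePrincipal :=
    GSpaceOver.isDNumerablePrincipal_pullback_universalBundle f.smooth
  -- The map `[x, k] ↦ Eh(x) · k` is well defined because `Eh(x g) = Eh(x) h(g)` cancels the factor
  -- `h(g)⁻¹`; it covers `Bh ∘ f`.
  let φ : (P.extend h).Total → EG G' := Quotient.lift
    (fun a : P.Total × G' => EG.act (EG.map h a.1.1.2) a.2) (by
      rintro a b ⟨g, rfl⟩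
      exact (EG.act_map_act h a.1.1.2 g a.2).symm)
  refine GSpaceOver.IsTorsor.iso_pullback (P := P.extend h) (Φ := φ)
    (GSpaceOver.extend_isDNumerablePrincipal h hh hP).isTorsor ?_ (fun c k => ?_) fun c => ?_
  · exact dSmooth_of_mk fun n p hp => EG.act_plot (EG.map_smooth hh n _ hp.1.2) hp.2
  · exact Quotient.inductionOn c fun a => EG.act_mul _ _ _
  · refine Quotient.inductionOn c fun a => ?_
    refine Eq.trans ?_ (EG.mk_act (EG.map h a.1.1.2) a.2).symm
    exact congrArg (BG.map h hh).toFun a.1.2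

end

end DBun

end

theorem mainTheorem10 {G G' B : Type u}
    [Group G] [DiffeologicalSpace G] [DBun.DiffeologicalGroup G]
    [Group G'] [DiffeologicalSpace G'] [DBun.DiffeologicalGroup G']
    [DiffeologicalSpace B] (h : G →* G') (hh : DSmooth h) :
    ∃ (θ : DBun.HomotopyClass B (DBun.BG G) → DBun.PrinD G B)
      (θ' : DBun.HomotopyClass B (DBun.BG G') → DBun.PrinD G' B),
      DBun.IsPullbackMap θ ∧ DBun.IsPullbackMap θ' ∧
      Function.Bijective θ ∧ Function.Bijective θ' ∧
      ∀ c : DBun.HomotopyClass B (DBun.BG G),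
        θ' (DBun.HomotopyClass.postcomp (DBun.BG.map h hh) c) = DBun.PrinD.extend h hh (θ c) := by
  refine ⟨DBun.classify G B, DBun.classify G' B, DBun.isPullbackMap_classify G B,
    DBun.isPullbackMap_classify G' B, ⟨DBun.classify_injective G B, DBun.classify_surjective G B⟩,
    ⟨DBun.classify_injective G' B, DBun.classify_surjective G' B⟩, fun c => ?_⟩
  exact Quotient.inductionOn c fun f => Quotient.sound (s := DBun.prinSetoid G' B)
    (DBun.iso_extend_pullback h hh f).symm
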